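/- Let $G$ be a finite group and $n\ge 0$. Let $S_n$ be the Riemann sphere $\mathbb{C}\cup\{\infty\}$ with the open disks $|z-k|<\tfrac13$, $k=1,\dots,n$, removed, with marked points $p_k=k-\tfrac{i}{3}$. A $G$-cover of $S_n$ is a principal $G$-cover $\pi:\tilde S\to S_n$ ($G$ acting on the left) together with a point $\tilde p_k\in\pi^{-1}(p_k)$ for each $k$. Let $Y_n$ be the groupoid whose objects are the $G$-covers of $S_n$ and whose morphisms are the $G$-equivariant homeomorphisms of total spaces that induce the identity on $S_n$ and carry the chosen points to the chosen points. Let $T_n$ be the groupoid whose objects are the tuples $(g_1,\dots,g_n;h_1,\dots,h_n)$ of elements of $G$ with $g_1g_2\cdots g_n=1$; the morphisms $(\mathbf g;\mathbf h)\to(\mathbf g';\mathbf h')$ are the elements $x\in G$ with $xg_kx^{-1}=g_k'$ and $h_kx^{-1}=h_k'$ for all $k$, and composition is multiplication in $G$ ($x$ followed by $y$ is $yx$). The standard block $S_n(g_1,\dots,g_n;h_1,\dots,h_n)$ of such a tuple is the following $G$-cover of $S_n$: cut $S_n$ along the vertical rays from $k+\tfrac{i}{3}$ up to $\infty$, $k=1,\dots,n$,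 take the trivial cover $(S_n\setminus\text{cuts})\times G$ with $G$ acting by left multiplication on the second factor, and glue it along the cuts so that $(t,x)$ on the left-hand side of the $k$-th cut (the side of smaller real part) is identified with $(t,xg_k)$ on the right-hand side; the chosen points are $\tilde p_k=(p_k,h_k)$. Sending a tuple to its standard block, and a morphism $x$ to the isomorphism $\phi_x$ which multiplies the second coordinate on the right by $x^{-1}$, defines a functor $V:T_n\to Y_n$, and $V$ is an equivalence. So the groupoids $Y_n$ and $T_n$ are equivalent; in particular, every $G$-cover of $S_n$ is isomorphic, by an isomorphism that is trivial on $S_n$ and preserves the chosen points, to a standard block. -/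

import Mathlib

open CategoryTheory

universe u

noncomputable section

namespace GCovers

/-- The `k`-th removed hole: the open disk `|z - (k+1)| < 1/3` in the Riemann sphere
(`k : Fin n` is counted from `0`, so the centers are `1, 2, …, n`). -/
def hole {n : ℕ} (k : Fin n) : Set (OnePoint ℂ) :=
  (fun z : ℂ => (z : OnePoint ℂ)) '' Metric.ball ((k : ℂ) + 1) (1 / 3)

/-- The standard sphere `S_n`: the Riemann sphere `ℂ ∪ {∞}` with `n` open disks removed. -/
def StdSphere (n : ℕ) : Set (OnePoint ℂ) :=
  (⋃ k : Fin n, hole k)ᶜ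

theorem coe_mem_stdSphere {n : ℕ} (z : ℂ) :
    ((z : OnePoint ℂ) ∈ StdSphere n) ↔ ∀ k : Fin n, 1 / 3 ≤ ‖z - ((k : ℂ) + 1)‖ := by
  simp [StdSphere, hole, dist_eq_norm]

/-- The complex number `(k+1) - i/3` at the bottom of the `k`-th boundary circle. -/
def basePointC {n : ℕ} (k : Fin n) : ℂ := (k : ℂ) + 1 - Complex.I / 3

theorem basePointC_mem {n : ℕ} (k : Fin n) : (basePointC k : OnePoint ℂ) ∈ StdSphere n := by
  rw [coe_mem_stdSphere]
  intro l
  refine le_trans ?_ (Complex.abs_im_le_norm _)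
  simp [basePointC]

/-- The marked point `p_k` on the `k`-th boundary circle of `S_n`. -/
def basePoint {n : ℕ} (k : Fin n) : StdSphere n := ⟨(basePointC k : OnePoint ℂ), basePointC_mem k⟩

/-! ### The groupoid of `G`-covers of `S_n` -/

/-- A `G`-cover of `(S_n, p_1, …, p_n)`: a principal `G`-cover `proj : Total → S_n` (a quotient
map whose fibers are the `G`-orbits, for a continuous `G`-action such that every point has a
neighborhood with pairwise disjoint translates), together with a chosen point over each `p_k`. -/
structure GCover (G : Type u) [Group G] (n : ℕ) where
  Total : Type u
  [topTotal : TopologicalSpace Total]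
  [actTotal : MulAction G Total]
  proj : Total → StdSphere n
  isPrincipal : IsQuotientCoveringMap proj G
  pt : Fin n → Total
  proj_pt : ∀ k, proj (pt k) = basePoint k

attribute [instance] GCover.topTotal GCover.actTotal

/-- An isomorphism of `G`-covers which is trivial on the base `S_n`: a `G`-equivariant
homeomorphism over `S_n` which carries the chosen points to the chosen points. -/
@[ext]
structure GCover.Iso {G : Type u} [Group G] {n : ℕ} (E F : GCover G n) where
  toHomeo : E.Total ≃ₜ F.Total
  map_pt : ∀ k, toHomeo (E.pt k) = F.pt k
  proj_map : ∀ e, F.proj (toHomeo e) = E.proj e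
  map_smul : ∀ (a : G) (e : E.Total), toHomeo (a • e) = a • toHomeo e

/-- The groupoid `Y_n`: objects are the `G`-covers of `S_n`, morphisms are the isomorphisms of
`G`-covers which are trivial on `S_n`. -/
instance instGroupoidGCover (G : Type u) [Group G] (n : ℕ) : Groupoid (GCover G n) where
  Hom := GCover.Iso
  id E := ⟨Homeomorph.refl _, fun _ => rfl, fun _ => rfl, fun _ _ => rfl⟩
  comp f g :=
    { toHomeo := f.toHomeo.trans g.toHomeo
      map_pt := fun k => by simp [f.map_pt, g.map_pt]
      proj_map := fun e => by simp [f.proj_map, g.proj_map]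
      map_smul := fun a e => by simp [f.map_smul, g.map_smul] }
  inv f :=
    { toHomeo := f.toHomeo.symm
      map_pt := fun k => by rw [← f.map_pt, Homeomorph.symm_apply_apply]
      proj_map := fun e => by rw [← f.proj_map, Homeomorph.apply_symm_apply]
      map_smul := fun a e => by
        apply f.toHomeo.injective
        rw [f.map_smul, Homeomorph.apply_symm_apply, Homeomorph.apply_symm_apply] }
  inv_comp f := GCover.Iso.ext (Homeomorph.ext fun e => f.toHomeo.apply_symm_apply e)
  comp_inv f := GCover.Iso.ext (Homeomorph.ext fun e => f.toHomeo.symm_apply_apply e)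

/-! ### The groupoid of standard blocks -/

/-- The data `(g_1, …, g_n; h_1, …, h_n)` of a standard block, with `g_1 g_2 ⋯ g_n = 1`. -/
@[ext]
structure StdBlock (G : Type u) [Group G] (n : ℕ) where
  g : Fin n → G
  h : Fin n → G
  prod_g : (List.ofFn g).prod = 1

/-- Morphisms of standard blocks: the `x : G` with `x g_i x⁻¹ = g'_i` and `h_i x⁻¹ = h'_i`. -/
@[ext]
structure StdBlock.Iso {G : Type u} [Group G] {n : ℕ} (s t : StdBlock G n) where
  x : G
  conj_g : ∀ i, x * s.g i * x⁻¹ = t.g i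
  mul_h : ∀ i, s.h i * x⁻¹ = t.h i

/-- The groupoid `T_n` of standard blocks; composition is multiplication in `G`. -/
instance instGroupoidStdBlock (G : Type u) [Group G] (n : ℕ) : Groupoid (StdBlock G n) where
  Hom := StdBlock.Iso
  id s := ⟨1, fun i => by simp, fun i => by simp⟩
  comp a b :=
    { x := b.x * a.x
      conj_g := fun i => by rw [← b.conj_g, ← a.conj_g]; group
      mul_h := fun i => by rw [← b.mul_h, ← a.mul_h]; group }
  id_comp a := StdBlock.Iso.ext (mul_one a.x)
  comp_id a := StdBlock.Iso.ext (one_mul a.x)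
  assoc a b c := StdBlock.Iso.ext (mul_assoc c.x b.x a.x).symm
  inv a :=
    { x := a.x⁻¹
      conj_g := fun i => by rw [← a.conj_g]; group
      mul_h := fun i => by rw [← a.mul_h]; group }
  inv_comp a := StdBlock.Iso.ext (mul_inv_cancel a.x)
  comp_inv a := StdBlock.Iso.ext (inv_mul_cancel a.x)

/-! ### The `G`-cover of `S_n` given by a standard block

The `k`-th cut runs from the top of the `k`-th boundary circle straight up to `q = ∞`. The cover
is `(S_n ∖ cuts) × G`, glued along the cuts: `(t, x)` on the left-hand side of the `k`-th cut is
glued to `(t, x g_k)` on its right-hand side. The gluing is carried out with two charts: the chart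
over `S_n ∖ cuts`, and a chart over an open neighborhood of the union of the cuts. In the latter
the sheet with label `y` is the one which, followed from the left of the first cut to the region
between the `k`-th and the `(k+1)`-st cut, has label `y g_1 ⋯ g_k` in the former. -/

/-- The `k`-th cut: the vertical ray from the top point `(k+1) + i/3` of the `k`-th boundary circle
to `∞`, both end points included. -/
def cut {n : ℕ} (k : Fin n) : Set (OnePoint ℂ) :=
  insert OnePoint.infty
    ((fun z : ℂ => (z : OnePoint ℂ)) '' {z : ℂ | z.re = (k : ℝ) + 1 ∧ 1 / 3 ≤ z.im})

/-- `S_n ∖ cuts`. -/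
def cutSphere (n : ℕ) : Set (StdSphere n) := {p | ∀ k : Fin n, (p : OnePoint ℂ) ∉ cut k}

/-- An open neighborhood of the union of the cuts: `S_n` without the closed lower half-disk
`{z | Im z ≤ 0, |z| ≤ n + 1}`. -/
def nearCuts (n : ℕ) : Set (StdSphere n) :=
  {p | (p : OnePoint ℂ) ∉
    (fun z : ℂ => (z : OnePoint ℂ)) '' {z : ℂ | z.im ≤ 0 ∧ ‖z‖ ≤ (n : ℝ) + 1}}

/-- The change of label from the chart near the cuts to the chart over `S_n ∖ cuts`: right
multiplication by the ordered product `g_1 ⋯ g_k` of the labels of the cuts to the left of `z`, if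
`z` is in the upper half-plane. In the rest of `nearCuts n` there is nothing to change. -/
def shift {G : Type u} [Group G] {n : ℕ} (t : StdBlock G n) : OnePoint ℂ → G
  | none => 1
  | some z =>
    if 0 < z.im then (List.ofFn fun k : Fin n => if (k : ℝ) + 1 < z.re then t.g k else 1).prod
    else 1

theorem isOpen_cutSphere (n : ℕ) : IsOpen (cutSphere n) := by
  have key : ∀ k : Fin n, IsClosed (cut k) := by
    intro k
    have h : IsClosed {z : ℂ | z.re = (k : ℝ) + 1 ∧ 1 / 3 ≤ z.im} :=
      (isClosed_eq Complex.continuous_re continuous_const).inter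
        (isClosed_le continuous_const Complex.continuous_im)
    rw [← isOpen_compl_iff, OnePoint.isOpen_iff_of_notMem (by simp [cut])]
    convert h.isOpen_compl using 1
    ext z
    simp [cut]
  have h : cutSphere n = ⋂ k : Fin n, (Subtype.val ⁻¹' (cut k)ᶜ : Set (StdSphere n)) := by
    ext p
    simp [cutSphere]
  rw [h]
  exact isOpen_iInter_of_finite fun k => (key k).isOpen_compl.preimage continuous_subtype_val

theorem isOpen_nearCuts (n : ℕ) : IsOpen (nearCuts n) := by
  have h1 : IsClosed {z : ℂ | z.im ≤ 0 ∧ ‖z‖ ≤ (n : ℝ) + 1} :=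
    (isClosed_le Complex.continuous_im continuous_const).inter
      (isClosed_le continuous_norm continuous_const)
  have h2 : IsCompact {z : ℂ | z.im ≤ 0 ∧ ‖z‖ ≤ (n : ℝ) + 1} := by
    refine (isCompact_closedBall (0 : ℂ) ((n : ℝ) + 1)).of_isClosed_subset h1 ?_
    intro z hz
    simpa using hz.2
  exact (OnePoint.isOpen_compl_image_coe.2 ⟨h1, h2⟩).preimage continuous_subtype_val

theorem mem_cutSphere_or_mem_nearCuts {n : ℕ} (p : StdSphere n) (hp : p ∉ cutSphere n) :
    p ∈ nearCuts n := by
  rintro ⟨z, hz, hzp⟩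
  apply hp
  intro k hk
  rw [← hzp] at hk
  rcases hk with hk | ⟨w, hw, hwz⟩
  · exact OnePoint.coe_ne_infty z hk
  · have : w = z := OnePoint.coe_injective hwz
    subst this
    have h1 := hz.1
    have h2 := hw.2
    linarith

theorem shift_continuousAt {G : Type u} [Group G] [TopologicalSpace G] {n : ℕ} (t : StdBlock G n)
    (p : StdSphere n) (hp : p ∈ cutSphere n) (hp' : p ∈ nearCuts n) :
    ContinuousAt (fun q : StdSphere n => shift t q) p := by
  suffices h : ∀ w : OnePoint ℂ, w = p → ContinuousAt (shift t) w from
    (h _ rfl).comp continuous_subtype_val.continuousAt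
  intro w hw
  induction w using OnePoint.rec with
  | infty =>
    rcases Nat.eq_zero_or_pos n with h0 | h0
    · subst h0
      have : shift t = fun _ => 1 := by
        funext q
        rcases q with _ | z
        · rfl
        · simp [shift]
      rw [this]
      exact continuousAt_const
    · exact absurd (by rw [← hw]; exact Or.inl rfl) (hp ⟨0, h0⟩)
  | coe z =>
    rw [OnePoint.continuousAt_coe]
    -- it is enough that `shift t` is constant near `z`
    suffices h : ∀ᶠ y : ℂ in nhds z, shift t (y : OnePoint ℂ) = shift t (z : OnePoint ℂ) from
      continuousAt_const.congr (h.mono fun y hy => hy.symm)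
    have hlt : ∀ {f g : ℂ → ℝ}, Continuous f → Continuous g → f z < g z →
        ∀ᶠ y in nhds z, f y < g y := fun hf hg h => hf.continuousAt.eventually_lt hg.continuousAt h
    rcases lt_trichotomy z.im 0 with him | him | him
    · filter_upwards [hlt Complex.continuous_im continuous_const him] with y hy
      change (if 0 < y.im then _ else (1 : G)) = if 0 < z.im then _ else (1 : G)
      rw [if_neg hy.not_gt, if_neg him.not_gt]
    · have hnorm : (n : ℝ) + 1 < |z.re| := by
        have h1 : ¬ ‖z‖ ≤ (n : ℝ) + 1 := fun h => hp' ⟨z, ⟨him.le, h⟩, hw⟩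
        have h2 : ‖z‖ = |z.re| := by
          rw [Complex.norm_eq_sqrt_sq_add_sq, him]
          simp [Real.sqrt_sq_eq_abs]
        rw [← h2]
        exact not_le.1 h1
      have hz1 : shift t (z : OnePoint ℂ) = 1 := if_neg him.not_gt
      rw [hz1]
      rcases lt_abs.1 hnorm with h | h
      · filter_upwards [hlt continuous_const Complex.continuous_re h] with y hy
        change (if 0 < y.im then _ else (1 : G)) = 1
        split_ifs
        · rw [← t.prod_g]
          congr 2
          funext k
          have : (k : ℝ) + 1 < y.re := by
            have : (k : ℝ) < n := by exact_mod_cast k.2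
            linarith
          rw [if_pos this]
        · rfl
      · have h0 : z.re < 0 := by
          have : (0 : ℝ) ≤ n := n.cast_nonneg
          linarith
        filter_upwards [hlt Complex.continuous_re continuous_const h0] with y hy
        change (if 0 < y.im then _ else (1 : G)) = 1
        split_ifs
        · have : (fun k : Fin n => if (k : ℝ) + 1 < y.re then t.g k else 1) = fun _ => 1 := by
            funext k
            have : ¬ (k : ℝ) + 1 < y.re := by
              have : (0 : ℝ) ≤ (k : ℝ) := Nat.cast_nonneg _
              linarith
            rw [if_neg this]
          rw [this]
          simp
        · rfl
    · have hne : ∀ k : Fin n, z.re ≠ (k : ℝ) + 1 := by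
        intro k hk
        have hs : (z : OnePoint ℂ) ∈ StdSphere n := hw ▸ p.2
        have h1 := (coe_mem_stdSphere z).1 hs k
        have h2 : ‖z - ((k : ℂ) + 1)‖ = z.im := by
          rw [Complex.norm_eq_sqrt_sq_add_sq]
          simp [hk, Real.sqrt_sq him.le]
        rw [h2] at h1
        exact hp k (by rw [← hw]; exact Or.inr ⟨z, ⟨hk, h1⟩, rfl⟩)
      have hev : ∀ᶠ y : ℂ in nhds z, ∀ k : Fin n, ((k : ℝ) + 1 < y.re ↔ (k : ℝ) + 1 < z.re) := by
        rw [Filter.eventually_all]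
        intro k
        rcases lt_or_gt_of_ne (hne k) with h | h
        · filter_upwards [hlt Complex.continuous_re continuous_const h] with y hy
          exact ⟨fun h' => absurd h' hy.not_gt, fun h' => absurd h' h.not_gt⟩
        · filter_upwards [hlt continuous_const Complex.continuous_re h] with y hy
          exact ⟨fun _ => h, fun _ => hy⟩
      filter_upwards [hev, hlt continuous_const Complex.continuous_im him] with y hy hy0
      change (if 0 < y.im then _ else (1 : G)) = if 0 < z.im then _ else (1 : G)
      rw [if_pos hy0, if_pos him]
      simp only [hy]

theorem shift_conj {G : Type u} [Group G] {n : ℕ} {s t : StdBlock G n} (a : s ⟶ t) (w : OnePoint ℂ) :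
    shift t w = a.x * shift s w * a.x⁻¹ := by
  rcases w with _ | z
  · simp [shift]
  · simp only [shift]
    split_ifs
    · have h : (fun k : Fin n => if (k : ℝ) + 1 < z.re then t.g k else 1) =
          MulAut.conj a.x ∘ fun k : Fin n => if (k : ℝ) + 1 < z.re then s.g k else 1 := by
        funext k
        simp only [Function.comp, MulAut.conj_apply]
        split_ifs
        · exact (a.conj_g k).symm
        · simp
      rw [h, ← List.map_ofFn, ← MulAut.conj_apply, map_list_prod]
    · simp

/-- The change of label from the chart `i` to the chart over `S_n ∖ cuts`; here `true` stands for
the chart over `S_n ∖ cuts` itself and `false` for the chart near the cuts. -/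
def chartShift {G : Type u} [Group G] {n : ℕ} (t : StdBlock G n) (i : Bool) (p : StdSphere n) : G :=
  if i then 1 else shift t p

/-- The domains of the two charts. -/
def chartDomain (n : ℕ) (i : Bool) : Set (StdSphere n) :=
  if i then cutSphere n else nearCuts n

theorem chartShift_continuousOn {G : Type u} [Group G] [TopologicalSpace G] {n : ℕ}
    (t : StdBlock G n) (i j : Bool) (hij : i ≠ j) :
    ContinuousOn (chartShift t i) (chartDomain n i ∩ chartDomain n j) := by
  rcases i with _ | _ <;> rcases j with _ | _
  · exact absurd rfl hij
  · exact fun p hp => (shift_continuousAt t p hp.2 hp.1).continuousWithinAt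
  · exact continuousOn_const
  · exact absurd rfl hij

open Classical in
/-- The gluing of the two trivial covers `(S_n ∖ cuts) × G` and `nearCuts × G`. The label `v` in the
chart `false` becomes `v * shift t p` in the chart `true`. -/
def blockCore {G : Type u} [Group G] [TopologicalSpace G] [DiscreteTopology G] {n : ℕ}
    (t : StdBlock G n) : FiberBundleCore Bool (StdSphere n) G where
  baseSet := chartDomain n
  isOpen_baseSet i := by
    rcases i with _ | _
    · exact isOpen_nearCuts n
    · exact isOpen_cutSphere n
  indexAt p := if p ∈ cutSphere n then true else false
  mem_baseSet_at p := by
    by_cases hp : p ∈ cutSphere n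
    · simp [hp, chartDomain]
    · simpa [hp, chartDomain] using mem_cutSphere_or_mem_nearCuts p hp
  coordChange i j p v := v * chartShift t i p * (chartShift t j p)⁻¹
  coordChange_self i p _ v := by group
  continuousOn_coordChange i j := by
    by_cases hij : i = j
    · subst hij
      simpa using continuous_snd.continuousOn
    · have hi := (chartShift_continuousOn t i j hij).comp
        (continuous_fst (X := StdSphere n) (Y := G)).continuousOn
        (s := (chartDomain n i ∩ chartDomain n j) ×ˢ Set.univ) (fun q hq => hq.1)
      have hj := (chartShift_continuousOn t j i (Ne.symm hij)).comp
        (continuous_fst (X := StdSphere n) (Y := G)).continuousOn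
        (s := (chartDomain n i ∩ chartDomain n j) ×ˢ Set.univ) (fun q hq => ⟨hq.1.2, hq.1.1⟩)
      exact (continuous_snd.continuousOn.mul hi).mul hj.inv
  coordChange_comp i j k p _ v := by group

section Block

variable {G : Type u} [Group G] [TopologicalSpace G] [DiscreteTopology G] {n : ℕ}

/-- A family of maps of labels, the same on all fibers, which respects the gluing, gives a
continuous map of the glued spaces. -/
theorem continuous_fiberwise (s t : StdBlock G n) (φ : G → G)
    (hφ : ∀ i j p v, φ ((blockCore s).coordChange i j p v) = (blockCore t).coordChange i j p (φ v)) :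
    Continuous (fun e : (blockCore s).TotalSpace => (⟨e.1, φ e.2⟩ : (blockCore t).TotalSpace)) := by
  rw [continuous_iff_continuousAt]
  intro e
  rw [FiberBundle.continuousAt_totalSpace]
  refine ⟨(blockCore s).continuous_proj.continuousAt, ?_⟩
  have h1 := ((FiberBundle.continuousAt_totalSpace G (fun x : (blockCore s).TotalSpace => x)).1
    (continuousAt_id (x := e))).2
  have h2 : ContinuousAt φ (trivializationAt G (blockCore s).Fiber e.1 e).2 :=
    continuous_of_discreteTopology.continuousAt
  exact (ContinuousAt.comp (f := fun x => (trivializationAt G (blockCore s).Fiber e.1 x).2)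
    h2 h1).congr (Filter.Eventually.of_forall fun x => hφ _ _ _ _)

/-- The point with label `v` over `p` in the glued space; the label refers to the chart over
`S_n ∖ cuts` if `p` is not on a cut, and to the chart near the cuts otherwise. -/
def blockPt (t : StdBlock G n) (p : StdSphere n) (v : G) : (blockCore t).TotalSpace := ⟨p, v⟩

/-- The label of a point of the glued space. -/
def label (t : StdBlock G n) (e : (blockCore t).TotalSpace) : G := e.2

/-- `G` acts on the glued space by left multiplication on the labels. -/
instance blockAction (t : StdBlock G n) : MulAction G (blockCore t).TotalSpace where
  smul a e := blockPt t e.1 (a * label t e)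
  one_smul e := congrArg (blockPt t e.1) (one_mul (label t e))
  mul_smul a b e := congrArg (blockPt t e.1) (mul_assoc a b (label t e))

theorem block_isPrincipal (t : StdBlock G n) :
    IsQuotientCoveringMap (blockCore t).proj G := by
  rw [isQuotientCoveringMap_iff_isCoveringMap_and]
  refine ⟨FiberBundle.isCoveringMap, fun p => ⟨blockPt t p 1, rfl⟩, ⟨fun a => ?_⟩, ⟨?_⟩, ?_⟩
  · exact continuous_fiberwise t t (fun v => a * v) fun i j p v => by
      simp only [blockCore, mul_assoc]
  · intro a b e h
    have h2 : a * label t e = b * label t e := eq_of_heq (Bundle.TotalSpace.mk.inj h).2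
    exact mul_right_cancel h2
  · rintro ⟨p, v⟩ ⟨q, w⟩
    constructor
    · intro h
      have h' : p = q := h
      subst h'
      exact ⟨label t ⟨p, v⟩ * (label t ⟨p, w⟩)⁻¹,
        congrArg (blockPt t p) (inv_mul_cancel_right (label t ⟨p, v⟩) (label t ⟨p, w⟩))⟩
    · rintro ⟨a, h⟩
      exact (congrArg Bundle.TotalSpace.proj h).symm

/-- The standard block `S_n(g_1, …, g_n; h_1, …, h_n)` as a `G`-cover of `S_n`. The chosen point
over `p_k` is `(p_k, h_k)` (in the chart over `S_n ∖ cuts`, to which `p_k` belongs). -/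
def block (t : StdBlock G n) : GCover G n where
  Total := (blockCore t).TotalSpace
  proj := (blockCore t).proj
  isPrincipal := block_isPrincipal t
  pt k := blockPt t (basePoint k) (t.h k)
  proj_pt _ := rfl

/-- Right multiplication by `x⁻¹` on the labels. -/
def blockMapFun {s t : StdBlock G n} (a : s ⟶ t) (e : (blockCore s).TotalSpace) :
    (blockCore t).TotalSpace :=
  blockPt t e.1 (label s e * a.x⁻¹)

theorem continuous_blockMapFun {s t : StdBlock G n} (a : s ⟶ t) : Continuous (blockMapFun a) := by
  refine continuous_fiberwise s t (fun v => v * a.x⁻¹) fun i j p v => ?_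
  have h : ∀ i, chartShift t i p = a.x * chartShift s i p * a.x⁻¹ := by
    intro i
    rcases i with _ | _
    · exact shift_conj a p
    · simp [chartShift]
  simp only [blockCore, h]
  group

/-- The isomorphism `φ_x` of `G`-covers: right multiplication by `x⁻¹` on the labels. -/
def blockMap {s t : StdBlock G n} (a : s ⟶ t) : block s ⟶ block t where
  toHomeo :=
    { toFun := blockMapFun a
      invFun := blockMapFun (Groupoid.inv a)
      left_inv := fun e => congrArg (blockPt s _) (mul_inv_cancel_right (label s e) a.x⁻¹)
      right_inv := fun e => congrArg (blockPt t _)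
        (inv_mul_cancel_right (label t e) a.x⁻¹)
      continuous_toFun := continuous_blockMapFun a
      continuous_invFun := continuous_blockMapFun (Groupoid.inv a) }
  map_pt k := congrArg (blockPt t (basePoint k)) (a.mul_h k)
  proj_map _ := rfl
  map_smul b e := congrArg (blockPt t _) (mul_assoc b (label s e) a.x⁻¹)

end Block

/-- The functor `V : T_n ⥤ Y_n` which sends a standard block to the corresponding `G`-cover of `S_n`
and the morphism given by `x` to the isomorphism `φ_x`. -/
def blockFunctor (G : Type u) [Group G] [TopologicalSpace G] [DiscreteTopology G] (n : ℕ) :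
    StdBlock G n ⥤ GCover G n where
  obj := block
  map := blockMap
  map_id s := GCover.Iso.ext <| Homeomorph.ext fun e => congrArg (blockPt s _)
    (show label s e * (1 : G)⁻¹ = label s e by rw [inv_one, mul_one])
  map_comp {s t r} a b := GCover.Iso.ext <| Homeomorph.ext fun e => congrArg (blockPt r _)
    (show label s e * (b.x * a.x)⁻¹ = label s e * a.x⁻¹ * b.x⁻¹ by rw [mul_inv_rev, mul_assoc])

end GCovers

end

/-! Off the cuts, the finite part of `S_n` contracts to a point: points are slid away from the axes
of the holes, pushed straight down below all holes, and contracted inside a half-plane. The part of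
`S_n` in the open upper half-plane also contracts, by pushing up. By homotopy lifting every
`G`-cover has a section over each of these two regions (`exists_isSection_cutPlane`,
`exists_isSection_upperSphere`), and by unique lifting two sections over a preconnected region
differ by one element of `G` (`IsSection.exists_eq_smul`).

The two regions meet in the `n + 1` vertical strips between consecutive cuts, so the two sections
differ by constants `b 0, …, b n`. With `a m = (b 0)⁻¹ * b m`, the quotients `(a k)⁻¹ * a (k + 1)`
are the labels of the cuts, and their partial products telescope to `a m`. A local section at `∞`
can be compared with both sections on the far left and on the far right; this forces `a n = 1`,
which is the relation `g_1 ⋯ g_n = 1`. Gluing the sections gives an isomorphism from a standard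
block (`exists_iso_of_sections`, `exists_block_iso`): `V` is essentially surjective.

For fullness (`exists_blockMap_eq`), an isomorphism of blocks is right multiplication by a constant
`c` off the cuts. Comparison with the upper half-plane, strip by strip, shows that `c⁻¹` conjugates
one family of labels into the other, and the marked points give the condition on the `h_k`.
Faithfulness is visible on a single fiber. -/

noncomputable section

namespace GCovers

open Set Filter Topology

/-! ### Plane regions -/

/-- The finite part of `S_n`, as a subset of `ℂ`. -/
def finiteSphere (n : ℕ) : Set ℂ := {z | (z : OnePoint ℂ) ∈ StdSphere n}

theorem mem_finiteSphere {n : ℕ} {z : ℂ} :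
    z ∈ finiteSphere n ↔ ∀ k : Fin n, 1 / 9 ≤ (z.re - (k + 1)) ^ 2 + z.im ^ 2 := by
  refine (coe_mem_stdSphere z).trans (forall_congr' fun k => ?_)
  rw [Complex.norm_eq_sqrt_sq_add_sq, Real.le_sqrt' (by norm_num)]
  norm_num

/-- The number of cuts to the left of the vertical line with real part `x`. -/
def sector (n : ℕ) (x : ℝ) : ℕ := min n (⌈x⌉₊ - 1)

theorem sector_le (n : ℕ) (x : ℝ) : sector n x ≤ n := min_le_left _ _

/-- The ceiling makes the inequality strict, so a point on a cut counts as lying to its left. For `x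
≤ 0` the truncated subtraction gives `0`, as it should. -/
theorem lt_sector_iff {n : ℕ} {x : ℝ} (k : Fin n) : (k : ℕ) < sector n x ↔ (k : ℝ) + 1 < x := by
  have h : ((k : ℕ) + 1 < ⌈x⌉₊) ↔ (k : ℝ) + 1 < x := by
    rw [Nat.lt_ceil]; push_cast; rfl
  rw [← h, sector, lt_min_iff]
  have := k.2
  omega

theorem sector_congr {n : ℕ} {x y : ℝ} (h : ∀ k : Fin n, (k : ℝ) + 1 < x ↔ (k : ℝ) + 1 < y) :
    sector n x = sector n y := by
  have hx := sector_le n x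
  have hy := sector_le n y
  rcases lt_trichotomy (sector n x) (sector n y) with hlt | heq | hlt
  · have := (lt_sector_iff ⟨_, hlt.trans_le hy⟩).2 ((h _).2 ((lt_sector_iff _).1 hlt))
    exact absurd this (lt_irrefl _)
  · exact heq
  · have := (lt_sector_iff ⟨_, hlt.trans_le hx⟩).2 ((h _).1 ((lt_sector_iff _).1 hlt))
    exact absurd this (lt_irrefl _)

theorem sector_eq_of {n m : ℕ} (hm : m ≤ n) {x : ℝ}
    (h : ∀ k : Fin n, (k : ℝ) + 1 < x ↔ (k : ℕ) < m) : sector n x = m := by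
  have hx := sector_le n x
  rcases lt_trichotomy (sector n x) m with hlt | heq | hlt
  · have := (lt_sector_iff ⟨_, hlt.trans_le hm⟩).2 ((h _).2 hlt)
    exact absurd this (lt_irrefl _)
  · exact heq
  · have := (h ⟨m, hlt.trans_le hx⟩).1 ((lt_sector_iff _).1 hlt)
    exact absurd this (lt_irrefl _)

theorem sector_add_half {n m : ℕ} (hm : m ≤ n) : sector n (m + 1 / 2) = m := by
  refine sector_eq_of hm fun k => ⟨fun h => ?_, fun h => ?_⟩
  · by_contra hk
    have : (m : ℝ) ≤ k := by exact_mod_cast not_lt.1 hk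
    linarith
  · have : (k : ℝ) + 1 ≤ m := by exact_mod_cast h
    linarith

/-- The abscissa `sector + 1/2` stays on the same side of every cut as `x`, at distance at least
`1/2` from it. -/
theorem half_le_or {n : ℕ} (x : ℝ) (k : Fin n) :
    ((k : ℝ) + 1 < x ∧ (k : ℝ) + 1 + 1 / 2 ≤ sector n x + 1 / 2) ∨
      (x ≤ (k : ℝ) + 1 ∧ (sector n x : ℝ) + 1 / 2 ≤ (k : ℝ) + 1 - 1 / 2) := by
  by_cases h : (k : ℝ) + 1 < x
  · have h1 : (k : ℝ) + 1 ≤ sector n x := by exact_mod_cast (lt_sector_iff k).2 h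
    exact Or.inl ⟨h, by linarith⟩
  · have h1 : (sector n x : ℝ) ≤ k := by exact_mod_cast not_lt.1 (mt (lt_sector_iff k).1 h)
    exact Or.inr ⟨not_lt.1 h, by linarith⟩

/-- The finite part of `S_n` without the cuts. -/
def cutPlane (n : ℕ) : Set ℂ := {z ∈ finiteSphere n | ∀ k : Fin n, z.re = k + 1 → z.im < 0}

/-- The part of `S_n` in the open upper half-plane. -/
def upperSphere (n : ℕ) : Set ℂ := {z ∈ finiteSphere n | 0 < z.im}

/-- The part of `S_n` in the open upper half-plane between two consecutive cuts. -/
def upperStrip (n m : ℕ) : Set ℂ := {z ∈ cutPlane n | 0 < z.im ∧ sector n z.re = m}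

theorem cutPlane_subset (n : ℕ) : cutPlane n ⊆ finiteSphere n := fun _ h => h.1

theorem upperSphere_subset (n : ℕ) : upperSphere n ⊆ finiteSphere n := fun _ h => h.1

theorem im_le_of_re_eq {n : ℕ} {z : ℂ} (hz : z ∈ cutPlane n) {k : Fin n} (hk : z.re = k + 1) :
    z.im ≤ -(1 / 3) := by
  have h1 := mem_finiteSphere.1 hz.1 k
  have h2 := hz.2 k hk
  rw [hk] at h1
  nlinarith

theorem mem_cutPlane_of_im {n : ℕ} {z : ℂ} (h : z.im ≤ -(1 / 3)) : z ∈ cutPlane n :=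
  ⟨mem_finiteSphere.2 fun k => by nlinarith [sq_nonneg (z.re - (k + 1))],
    fun _ _ => by linarith⟩

theorem mem_finiteSphere_of_im {n : ℕ} {z : ℂ} (h : 1 / 3 ≤ z.im) : z ∈ finiteSphere n :=
  mem_finiteSphere.2 fun k => by nlinarith [sq_nonneg (z.re - (k + 1))]

theorem coe_mem_cutSphere {n : ℕ} {z : ℂ} (hz : z ∈ finiteSphere n) :
    (⟨z, hz⟩ : StdSphere n) ∈ cutSphere n ↔ z ∈ cutPlane n := by
  have key : ∀ k : Fin n, (z : OnePoint ℂ) ∈ cut k ↔ z.re = k + 1 ∧ 1 / 3 ≤ z.im := by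
    intro k
    simp [cut]
  constructor
  · intro h
    refine ⟨hz, fun k hk => ?_⟩
    have h1 := h k
    rw [key] at h1
    have h2 := mem_finiteSphere.1 hz k
    rw [hk] at h2
    have h3 : z.im < 1 / 3 := not_le.1 fun h => h1 ⟨hk, h⟩
    nlinarith
  · intro h k hk
    have := (key k).1 hk
    linarith [h.2 k this.1]

theorem cutPlane_mem_nhdsWithin {n : ℕ} {z : ℂ} (hz : z ∈ cutPlane n) :
    cutPlane n ∈ 𝓝[finiteSphere n] z := by
  have h : ∀ k : Fin n, ∀ᶠ w : ℂ in 𝓝 z, w.re = (k : ℝ) + 1 → w.im < 0 := by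
    intro k
    by_cases hk : z.re = (k : ℝ) + 1
    · filter_upwards [Complex.continuous_im.continuousAt.eventually_lt continuousAt_const
        (hz.2 k hk)] with w hw _ using hw
    · filter_upwards [Complex.continuous_re.continuousAt.eventually_ne hk] with w hw h
      exact absurd h hw
  filter_upwards [self_mem_nhdsWithin, mem_nhdsWithin_of_mem_nhds (eventually_all.2 h)] with w h1 h2
    using ⟨h1, h2⟩

theorem upperSphere_mem_nhdsWithin {n : ℕ} {z : ℂ} (hz : z ∈ upperSphere n) :
    upperSphere n ∈ 𝓝[finiteSphere n] z := by
  filter_upwards [self_mem_nhdsWithin, mem_nhdsWithin_of_mem_nhds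
    (continuousAt_const.eventually_lt Complex.continuous_im.continuousAt hz.2)] with w h1 h2
    using ⟨h1, h2⟩

/-! ### Pushing the plane regions along segments -/

/-- The cut-off which is `0` below the holes and `1` in the upper half-plane. -/
def cutoff (y : ℝ) : ℝ := min 1 (max 0 (1 + 3 * y))

theorem cutoff_nonneg (y : ℝ) : 0 ≤ cutoff y := le_min zero_le_one (le_max_left _ _)

theorem cutoff_le_one (y : ℝ) : cutoff y ≤ 1 := min_le_left _ _

theorem cutoff_eq_one {y : ℝ} (hy : 0 ≤ y) : cutoff y = 1 := by
  rw [cutoff, max_eq_right (by linarith), min_eq_left (by linarith)]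

theorem cutoff_eq_zero {y : ℝ} (hy : y ≤ -(1 / 3)) : cutoff y = 0 := by
  rw [cutoff, max_eq_left (by linarith), min_eq_right zero_le_one]

theorem continuous_cutoff : Continuous cutoff := by
  unfold cutoff; fun_prop

/-- Move `z` horizontally by the fraction `s` of its distance to the middle of its strip. -/
def toMiddle (n : ℕ) (s : ℝ) (z : ℂ) : ℂ := ⟨z.re + s * (sector n z.re + 1 / 2 - z.re), z.im⟩

/-- The target abscissa is on the same side of each axis `Re = k + 1` as `z`, at distance at least
`1/2 > 1/3`. Along the way the distance to the axis is at least the smaller of its initial value and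
`1/2`, so no hole is entered and no cut is crossed. -/
theorem toMiddle_mem {n : ℕ} {s : ℝ} (h0 : 0 ≤ s) (h1 : s ≤ 1) {z : ℂ} (hz : z ∈ cutPlane n) :
    toMiddle n s z ∈ cutPlane n := by
  -- A point exactly on the axis `Re = k + 1` counts as being on its left. If the motion leaves it
  -- there, it still avoids the cut because `z` itself lies below the hole; hence the alternative
  -- `z.re = k + 1`.
  have key : ∀ k : Fin n, ((k : ℝ) + 1 < z.re ∧ (k : ℝ) + 1 < (toMiddle n s z).re ∧
      1 / 9 ≤ ((toMiddle n s z).re - (k + 1)) ^ 2 + z.im ^ 2) ∨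
      (z.re ≤ (k : ℝ) + 1 ∧ ((toMiddle n s z).re < (k : ℝ) + 1 ∨ z.re = k + 1) ∧
      1 / 9 ≤ ((toMiddle n s z).re - (k + 1)) ^ 2 + z.im ^ 2) := by
    intro k
    have hk := mem_finiteSphere.1 hz.1 k
    set c : ℝ := sector n z.re + 1 / 2 with hc
    have hre : (toMiddle n s z).re = z.re + s * (c - z.re) := rfl
    have hre' : z.re + s * (c - z.re) = (1 - s) * z.re + s * c := by ring
    rw [hre, hre']
    rcases half_le_or z.re k with ⟨h2, h3⟩ | ⟨h2, h3⟩
    · rw [← hc] at h3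
      have h4 : min (z.re) (k + 1 + 1 / 2) ≤ (1 - s) * z.re + s * c := by
        have := min_le_left z.re ((k : ℝ) + 1 + 1 / 2)
        have := min_le_right z.re ((k : ℝ) + 1 + 1 / 2)
        nlinarith
      left
      rcases min_choice z.re ((k : ℝ) + 1 + 1 / 2) with h | h <;> rw [h] at h4
      · exact ⟨h2, by linarith, by nlinarith⟩
      · exact ⟨h2, by linarith, by nlinarith [sq_nonneg z.im]⟩
    · rw [← hc] at h3
      have h4 : (1 - s) * z.re + s * c ≤ max (z.re) (k + 1 - 1 / 2) := by
        have := le_max_left z.re ((k : ℝ) + 1 - 1 / 2)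
        have := le_max_right z.re ((k : ℝ) + 1 - 1 / 2)
        nlinarith
      right
      rcases max_choice z.re ((k : ℝ) + 1 - 1 / 2) with h | h <;> rw [h] at h4
      · refine ⟨h2, ?_, by nlinarith⟩
        rcases h2.lt_or_eq with h5 | h5
        · exact Or.inl (by linarith)
        · exact Or.inr h5
      · exact ⟨h2, Or.inl (by linarith), by nlinarith [sq_nonneg z.im]⟩
  refine ⟨mem_finiteSphere.2 fun k => ?_, fun k hk => ?_⟩
  · rcases key k with h | h
    · exact h.2.2
    · exact h.2.2
  · rcases key k with h | h
    · exact absurd hk h.2.1.ne'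
    · rcases h.2.1 with h' | h'
      · exact absurd hk h'.ne
      · exact hz.2 k h'

/-- Move `z` to the middle of its strip, except below the holes. -/
def pushAside (n : ℕ) (z : ℂ) : ℂ := toMiddle n (cutoff z.im) z

/-- The function `sector` jumps only across the lines `Re = k + 1`, and in `cutPlane` those lines
survive only for `Im ≤ -1/3`, where the cut-off vanishes. -/
theorem continuousOn_pushAside (n : ℕ) : ContinuousOn (pushAside n) (cutPlane n) := by
  suffices h : ContinuousOn (fun z : ℂ => cutoff z.im * (sector n z.re + 1 / 2 - z.re))
      (cutPlane n) by
    have h2 : ContinuousOn (fun z : ℂ => z + ((cutoff z.im * (sector n z.re + 1 / 2 - z.re) : ℝ) : ℂ))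
        (cutPlane n) := continuousOn_id.add (Complex.continuous_ofReal.comp_continuousOn h)
    refine h2.congr fun z _ => ?_
    apply Complex.ext <;> simp [pushAside, toMiddle]
  intro z hz
  by_cases hk : ∃ k : Fin n, z.re = k + 1
  · obtain ⟨k, hk⟩ := hk
    have h0 : cutoff z.im = 0 := cutoff_eq_zero (im_le_of_re_eq hz hk)
    apply ContinuousAt.continuousWithinAt
    unfold ContinuousAt
    simp only [h0, zero_mul]
    -- The bracket jumps here but is bounded by `n + 1 + |Re w|`, so the product is squeezed to `0`
    -- by the cut-off.
    have h1 : Tendsto (fun w : ℂ => cutoff w.im * (n + 1 + |w.re|)) (𝓝 z) (𝓝 0) := by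
      have : Continuous (fun w : ℂ => cutoff w.im * (n + 1 + |w.re|)) := by
        have := continuous_cutoff
        have := Complex.continuous_re
        have := Complex.continuous_im
        fun_prop
      simpa [h0] using this.tendsto z
    refine squeeze_zero_norm (fun w => ?_) h1
    rw [Real.norm_eq_abs, abs_mul, abs_of_nonneg (cutoff_nonneg _)]
    refine mul_le_mul_of_nonneg_left ?_ (cutoff_nonneg _)
    have h2 : (sector n w.re : ℝ) ≤ n := by exact_mod_cast sector_le n w.re
    have h3 : (0 : ℝ) ≤ sector n w.re := Nat.cast_nonneg _
    rw [abs_le]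
    constructor <;> linarith [neg_abs_le w.re, le_abs_self w.re]
  · push Not at hk
    have hev : ∀ᶠ w : ℂ in 𝓝 z, ∀ k : Fin n, ((k : ℝ) + 1 < w.re ↔ (k : ℝ) + 1 < z.re) := by
      rw [eventually_all]
      intro k
      rcases lt_or_gt_of_ne (hk k) with h | h
      · filter_upwards [Complex.continuous_re.continuousAt.eventually_lt continuousAt_const h]
          with w hw
        exact ⟨fun h' => absurd h' hw.not_gt, fun h' => absurd h' h.not_gt⟩
      · filter_upwards [continuousAt_const.eventually_lt Complex.continuous_re.continuousAt h]
          with w hw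
        exact ⟨fun _ => h, fun _ => hw⟩
    have h1 : ContinuousAt (fun w : ℂ => cutoff w.im * (sector n z.re + 1 / 2 - w.re)) z := by
      have := continuous_cutoff
      have := Complex.continuous_re
      have := Complex.continuous_im
      fun_prop
    refine (h1.congr ?_).continuousWithinAt
    filter_upwards [hev] with w hw
    rw [sector_congr hw]

theorem pushAside_sub_mem {n : ℕ} {z : ℂ} (hz : z ∈ cutPlane n) {s : ℝ} (hs : 0 ≤ s) :
    pushAside n z - (s : ℂ) * Complex.I ∈ cutPlane n := by
  have h := toMiddle_mem (cutoff_nonneg z.im) (cutoff_le_one z.im) hz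
  have hre : (pushAside n z - (s : ℂ) * Complex.I).re = (pushAside n z).re := by simp
  have him : (pushAside n z - (s : ℂ) * Complex.I).im = z.im - s := by simp [pushAside, toMiddle]
  -- Below the real axis, moving down only increases the distance to the holes. From the real axis
  -- upwards the cut-off is `1`, so the point is already on the middle line of its strip, and that
  -- whole line avoids holes and cuts.
  rcases lt_or_ge z.im 0 with h0 | h0
  · refine ⟨mem_finiteSphere.2 fun k => ?_, fun k _ => by rw [him]; linarith⟩
    have := mem_finiteSphere.1 h.1 k
    rw [hre, him]
    change 1 / 9 ≤ ((pushAside n z).re - _) ^ 2 + z.im ^ 2 at this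
    nlinarith
  · have hre' : (pushAside n z).re = sector n z.re + 1 / 2 := by
      simp [pushAside, toMiddle, cutoff_eq_one h0]
    rw [hre'] at hre
    refine ⟨mem_finiteSphere.2 fun k => ?_, fun k hk => ?_⟩
    · rw [hre]
      rcases half_le_or z.re k with h | h <;> nlinarith [h.2, sq_nonneg
        (pushAside n z - (s : ℂ) * Complex.I).im]
    · rw [hre] at hk
      rcases half_le_or z.re k with h | h <;> linarith [h.2]

theorem lineMap_pushAside {n : ℕ} (z : ℂ) (t : ℝ) :
    AffineMap.lineMap z (pushAside n z) t = toMiddle n (t * cutoff z.im) z := by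
  apply Complex.ext <;> simp [AffineMap.lineMap_apply, pushAside, toMiddle]; ring

theorem lineMap_sub_I (z : ℂ) (a t : ℝ) :
    AffineMap.lineMap z (z - (a : ℂ) * Complex.I) t = z - ((t * a : ℝ) : ℂ) * Complex.I := by
  apply Complex.ext <;> simp [AffineMap.lineMap_apply]; ring

theorem lineMap_pushAside_mem {n : ℕ} {z : ℂ} (hz : z ∈ cutPlane n) {t : ℝ} (ht : t ∈ Icc (0 : ℝ) 1) :
    AffineMap.lineMap z (pushAside n z) t ∈ cutPlane n := by
  rw [lineMap_pushAside]
  exact toMiddle_mem (mul_nonneg ht.1 (cutoff_nonneg _))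
    (mul_le_one₀ ht.2 (cutoff_nonneg _) (cutoff_le_one _)) hz

/-- Move `z` straight down from `pushAside n z` until it is below all holes. -/
def pushDown (n : ℕ) (z : ℂ) : ℂ := pushAside n z - ((|z.im| + 1 : ℝ) : ℂ) * Complex.I

theorem lineMap_pushDown_mem {n : ℕ} {z : ℂ} (hz : z ∈ cutPlane n) {t : ℝ} (ht : t ∈ Icc (0 : ℝ) 1) :
    AffineMap.lineMap (pushAside n z) (pushDown n z) t ∈ cutPlane n := by
  rw [pushDown, lineMap_sub_I]
  exact pushAside_sub_mem hz (mul_nonneg ht.1 (by positivity))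

theorem pushDown_im_le (n : ℕ) (z : ℂ) : (pushDown n z).im ≤ -1 := by
  have : (pushDown n z).im = z.im - (|z.im| + 1) := by simp [pushDown, pushAside, toMiddle]
  rw [this]
  linarith [le_abs_self z.im]

theorem continuousOn_pushDown (n : ℕ) : ContinuousOn (pushDown n) (cutPlane n) := by
  refine (continuousOn_pushAside n).sub (Continuous.continuousOn ?_)
  have := Complex.continuous_im
  fun_prop

theorem lineMap_up_mem {n : ℕ} {z : ℂ} (hz : z ∈ upperSphere n) {t : ℝ} (ht : t ∈ Icc (0 : ℝ) 1) :
    AffineMap.lineMap z (z + Complex.I) t ∈ upperSphere n := by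
  have h : AffineMap.lineMap z (z + Complex.I) t = (⟨z.re, z.im + t⟩ : ℂ) := by
    apply Complex.ext <;> simp [AffineMap.lineMap_apply]; ring
  rw [h]
  refine ⟨mem_finiteSphere.2 fun k => ?_, add_pos_of_pos_of_nonneg hz.2 ht.1⟩
  have h1 := mem_finiteSphere.1 hz.1 k
  have h2 := hz.2
  have h3 := ht.1
  change 1 / 9 ≤ (z.re - _) ^ 2 + (z.im + t) ^ 2
  nlinarith

/-! ### Connectedness -/

theorem isPreconnected_of_joinedIn {S C : Set ℂ} (hC : Convex ℝ C) (hCS : C ⊆ S)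
    (h : ∀ z ∈ S, ∃ w ∈ C, JoinedIn S z w) : IsPreconnected S := by
  rcases C.eq_empty_or_nonempty with rfl | ⟨c, hc⟩
  · have : S = ∅ := by
      ext z
      simp only [mem_empty_iff_false, iff_false]
      intro hz
      obtain ⟨w, hw, -⟩ := h z hz
      exact hw
    rw [this]
    exact isPreconnected_empty
  · refine IsPathConnected.isConnected ⟨c, hCS hc, fun {z} hz => ?_⟩ |>.isPreconnected
    obtain ⟨w, hw, hzw⟩ := h z hz
    have : JoinedIn S c w := JoinedIn.of_segment_subset ((hC.segment_subset hc hw).trans hCS)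
    exact this.trans hzw.symm

theorem joinedIn_of_lineMap {S : Set ℂ} {z w : ℂ}
    (h : ∀ t ∈ Icc (0 : ℝ) 1, AffineMap.lineMap z w t ∈ S) : JoinedIn S z w := by
  refine JoinedIn.of_segment_subset ?_
  rw [segment_eq_image_lineMap]
  rintro _ ⟨t, ht, rfl⟩
  exact h t ht

theorem isPreconnected_cutPlane (n : ℕ) : IsPreconnected (cutPlane n) := by
  refine isPreconnected_of_joinedIn (convex_halfSpace_im_le (-1))
    (fun z hz => mem_cutPlane_of_im (by have : z.im ≤ -1 := hz; linarith)) fun z hz => ?_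
  exact ⟨pushDown n z, pushDown_im_le n z,
    (joinedIn_of_lineMap fun t ht => lineMap_pushAside_mem hz ht).trans
      (joinedIn_of_lineMap fun t ht => lineMap_pushDown_mem hz ht)⟩

theorem isPreconnected_upperSphere (n : ℕ) : IsPreconnected (upperSphere n) := by
  refine isPreconnected_of_joinedIn (convex_halfSpace_im_ge 1) (fun z hz => ?_) fun z hz => ?_
  · have : 1 ≤ z.im := hz
    exact ⟨mem_finiteSphere_of_im (by linarith), by linarith⟩
  · refine ⟨z + Complex.I, ?_, joinedIn_of_lineMap fun t ht => lineMap_up_mem hz ht⟩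
    have := hz.2
    simp
    linarith

theorem middle_mem_upperStrip {n m : ℕ} (hm : m ≤ n) {z : ℂ} (hre : z.re = m + 1 / 2)
    (him : 0 < z.im) : z ∈ upperStrip n m := by
  have hs : sector n z.re = m := by rw [hre, sector_add_half hm]
  refine ⟨⟨mem_finiteSphere.2 fun k => ?_, fun k hk => ?_⟩, him, hs⟩
  · have := half_le_or z.re k
    rw [hs] at this
    rw [hre] at this ⊢
    rcases this with h | h <;> nlinarith [h.2, sq_nonneg z.im]
  · have := half_le_or z.re k
    rw [hs] at this
    rcases this with h | h <;> linarith [h.2]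

theorem isPreconnected_upperStrip {n m : ℕ} (hm : m ≤ n) : IsPreconnected (upperStrip n m) := by
  have hC : Convex ℝ {z : ℂ | z.re = m + 1 / 2 ∧ 0 < z.im} :=
    (convex_hyperplane (f := Complex.re) ⟨Complex.add_re, fun c z => by simp⟩ _).inter
      (convex_halfSpace_im_gt 0)
  refine isPreconnected_of_joinedIn hC (fun z hz => middle_mem_upperStrip hm hz.1 hz.2)
    fun z hz => ⟨pushAside n z, ⟨?_, hz.2.1⟩, joinedIn_of_lineMap fun t ht => ?_⟩
  · simp [pushAside, toMiddle, cutoff_eq_one hz.2.1.le, hz.2.2]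
  · refine ⟨lineMap_pushAside_mem hz.1 ht, ?_, ?_⟩
    · rw [lineMap_pushAside]
      exact hz.2.1
    · rw [lineMap_pushAside, cutoff_eq_one hz.2.1.le, mul_one]
      refine sector_eq_of hm fun k => ?_
      have h1 := half_le_or z.re k
      have h2 := lt_sector_iff (x := z.re) k
      rw [hz.2.2] at h1 h2
      rw [h2]
      have h3 := ht.1
      have h4 := ht.2
      simp only [toMiddle, hz.2.2]
      rcases h1 with h | h
      · refine ⟨fun _ => h.1, fun _ => ?_⟩
        rcases h3.eq_or_lt with rfl | h3
        · simpa using h.1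
        · nlinarith [mul_nonneg (sub_nonneg.2 h4) (sub_nonneg.2 h.1.le),
            mul_le_mul_of_nonneg_left h.2 h3.le]
      · exact ⟨fun h' => absurd h' (not_lt.2 (by nlinarith [h.1, h.2])),
          fun h' => absurd h' h.1.not_gt⟩

/-- The part of a half-plane far away from the origin. -/
theorem isPreconnected_halfPlane_far (l : ℂ →L[ℝ] ℝ) {a R : ℝ} (ha : 0 ≤ a) (hR : 0 ≤ R)
    (hl : ∀ z, l z ≤ ‖z‖) : IsPreconnected {z : ℂ | a < l z ∧ R < ‖z‖} := by
  -- The half-space `a + R < l z` lies in the region because `l z ≤ ‖z‖`. Radial dilation reaches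
  -- it, increasing both `l z` and `‖z‖`.
  refine isPreconnected_of_joinedIn (C := {z | a + R < l z})
    (convex_halfSpace_gt l.isLinear _) (fun z hz => ?_) fun z hz => ?_
  · have h : a + R < l z := hz
    exact ⟨by linarith, by linarith [hl z]⟩
  · have h0 : 0 < l z := ha.trans_lt hz.1
    have h1 : 0 ≤ (a + R) / l z := by positivity
    refine ⟨((a + R) / l z + 1) • z, ?_, joinedIn_of_lineMap fun t ht => ?_⟩
    · have : l (((a + R) / l z + 1) • z) = a + R + l z := by
        rw [map_smul, smul_eq_mul]; field_simp
      change a + R < l _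
      linarith
    · have h2 : AffineMap.lineMap z (((a + R) / l z + 1) • z) t = (1 + t * ((a + R) / l z)) • z := by
        rw [AffineMap.lineMap_apply_module]; module
      have h3 : 1 ≤ 1 + t * ((a + R) / l z) := by linarith [mul_nonneg ht.1 h1]
      rw [h2]
      refine ⟨?_, ?_⟩
      · rw [map_smul, smul_eq_mul]
        nlinarith [hz.1]
      · rw [norm_smul, Real.norm_of_nonneg (by linarith)]
        nlinarith [hz.2, norm_nonneg z]

variable {G : Type u} [Group G] {n : ℕ}

/-! ### The sphere and the plane -/

open Classical in
/-- A point of the plane as a point of `S_n`; points of the holes are sent to `∞`. -/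
def toSphere (n : ℕ) (z : ℂ) : StdSphere n :=
  if h : z ∈ finiteSphere n then ⟨z, h⟩ else ⟨OnePoint.infty, by simp [StdSphere, hole]⟩

/-- The point `∞` of `S_n`. -/
def inftyPoint (n : ℕ) : StdSphere n := ⟨OnePoint.infty, by simp [StdSphere, hole]⟩

theorem toSphere_of_mem {z : ℂ} (h : z ∈ finiteSphere n) : toSphere n z = ⟨z, h⟩ := dif_pos h

theorem coe_toSphere {z : ℂ} (h : z ∈ finiteSphere n) : (toSphere n z : OnePoint ℂ) = z := by
  rw [toSphere_of_mem h]

theorem eq_inftyPoint_or (p : StdSphere n) :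
    p = inftyPoint n ∨ ∃ z ∈ finiteSphere n, p = toSphere n z := by
  obtain ⟨p, hp⟩ := p
  induction p using OnePoint.rec with
  | infty => exact Or.inl rfl
  | coe z => exact Or.inr ⟨z, hp, (toSphere_of_mem hp).symm⟩

theorem continuousOn_toSphere (n : ℕ) : ContinuousOn (toSphere n) (finiteSphere n) := by
  rw [continuousOn_iff_continuous_domRestrict, continuous_induced_rng]
  exact (OnePoint.continuous_coe.comp continuous_subtype_val).congr fun z =>
    (coe_toSphere z.2).symm

/-- The affine coordinate on `S_n`, with value `0` at `∞`. -/
def toPlane (p : StdSphere n) : ℂ := OnePoint.elim (p : OnePoint ℂ) (0 : ℂ) id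

theorem toPlane_toSphere {z : ℂ} (h : z ∈ finiteSphere n) : toPlane (toSphere n z) = z := by
  rw [toSphere_of_mem h]; rfl

/-- The plane is open in the sphere, so neighborhoods of a finite point of `S_n` are computed in
`ℂ`. This transfers continuity of plane sections to `S_n`. -/
theorem tendsto_toPlane {z : ℂ} (h : z ∈ finiteSphere n) :
    Tendsto (toPlane (n := n)) (𝓝 (toSphere n z)) (𝓝[finiteSphere n] z) := by
  have h1 : map Subtype.val (𝓝 (toSphere n z)) = map ((↑) : ℂ → OnePoint ℂ) (𝓝[finiteSphere n] z) := by
    rw [map_nhds_subtype_val, coe_toSphere h, OnePoint.nhdsWithin_coe]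
    rfl
  have h2 : Tendsto (fun p : OnePoint ℂ => p.elim (0 : ℂ) id) (map Subtype.val (𝓝 (toSphere n z)))
      (𝓝[finiteSphere n] z) := by
    rw [h1, tendsto_map'_iff]
    exact tendsto_id
  exact tendsto_map'_iff.1 h2

theorem exists_norm_of_mem_nhds {V : Set (StdSphere n)} (hV : V ∈ 𝓝 (inftyPoint n)) :
    ∃ R : ℝ, (n : ℝ) + 1 < R ∧ ∀ z : ℂ, R < ‖z‖ → z ∈ finiteSphere n ∧ toSphere n z ∈ V := by
  rw [mem_nhds_subtype] at hV
  obtain ⟨W, hW, hWV⟩ := hV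
  have h1 : ∀ᶠ z : ℂ in coclosedCompact ℂ, (z : OnePoint ℂ) ∈ W := OnePoint.tendsto_coe_infty hW
  rw [coclosedCompact_eq_cocompact, ← Metric.cobounded_eq_cocompact, ← comap_norm_atTop, eventually_comap] at h1
  obtain ⟨R, hR⟩ := eventually_atTop.1 h1
  -- The centers of the holes have norm at most `n`, so a point of norm above `n + 2` is outside
  -- every hole.
  refine ⟨max R (n + 2), lt_of_lt_of_le (by linarith) (le_max_right _ _), fun z hz => ?_⟩
  have hzs : z ∈ finiteSphere n := by
    refine (coe_mem_stdSphere z).2 fun k => ?_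
    have h2 : ‖((k : ℂ) + 1)‖ = (k : ℝ) + 1 := by
      rw [← Nat.cast_add_one, Complex.norm_natCast]; push_cast; rfl
    have h3 := norm_sub_norm_le z ((k : ℂ) + 1)
    have h4 : (k : ℝ) + 1 ≤ n := by exact_mod_cast k.2
    have h5 := le_max_right R ((n : ℝ) + 2)
    rw [h2] at h3
    linarith
  refine ⟨hzs, hWV ?_⟩
  change (toSphere n z : OnePoint ℂ) ∈ W
  rw [coe_toSphere hzs]
  exact hR _ ((le_max_left _ _).trans hz.le) z rfl

/-! ### Lifts and sections over plane regions -/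

/-- `f` lifts to the total space of `E` over the plane region `U`. -/
def HasLift (E : GCover G n) (U : Set ℂ) (f : ℂ → ℂ) : Prop :=
  ∃ σ : ℂ → E.Total, ContinuousOn σ U ∧ ∀ z ∈ U, E.proj (σ z) = toSphere n (f z)

/-- `σ` is a section of `E` over the plane region `U`. -/
structure IsSection (E : GCover G n) (U : Set ℂ) (σ : ℂ → E.Total) : Prop where
  continuousOn : ContinuousOn σ U
  proj_eq : ∀ z ∈ U, E.proj (σ z) = toSphere n z

theorem hasLift_const (E : GCover G n) (U : Set ℂ) (w : ℂ) : HasLift E U fun _ => w := by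
  obtain ⟨e, he⟩ := E.isPrincipal.surjective (toSphere n w)
  exact ⟨fun _ => e, continuousOn_const, fun _ _ => he⟩

/-- This is homotopy lifting along the straight-line homotopy, with all of `U` as parameter space.
The homotopy starts at the lifted map `g` and ends at `f`, so the endpoints are interchanged with
respect to `h`. -/
theorem HasLift.of_lineMap {E : GCover G n} {U : Set ℂ} {f g : ℂ → ℂ} (hg : HasLift E U g)
    (hfc : ContinuousOn f U) (hgc : ContinuousOn g U)
    (h : ∀ z ∈ U, ∀ t ∈ Icc (0 : ℝ) 1, AffineMap.lineMap (f z) (g z) t ∈ finiteSphere n) :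
    HasLift E U f := by
  obtain ⟨σ, hσ, hσg⟩ := hg
  let H : C(unitInterval × U, StdSphere n) :=
    ⟨fun q => toSphere n (AffineMap.lineMap (g q.2) (f q.2) (q.1 : ℝ)), by
      refine (continuousOn_toSphere n).comp_continuous ?_ fun q => ?_
      · have h1 : Continuous fun q : unitInterval × U => g q.2 :=
          (continuousOn_iff_continuous_domRestrict.1 hgc).comp continuous_snd
        have h2 : Continuous fun q : unitInterval × U => f q.2 :=
          (continuousOn_iff_continuous_domRestrict.1 hfc).comp continuous_snd
        have h3 : Continuous fun q : unitInterval × U => (q.1 : ℝ) :=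
          continuous_subtype_val.comp continuous_fst
        simp only [AffineMap.lineMap_apply_module]
        exact ((continuous_const.sub h3).smul h1).add (h3.smul h2)
      · rw [← AffineMap.lineMap_apply_one_sub]
        exact h _ q.2.2 _ ⟨by linarith [q.1.2.2], by linarith [q.1.2.1]⟩⟩
  let f₀ : C(U, E.Total) := ⟨U.domRestrict σ, continuousOn_iff_continuous_domRestrict.1 hσ⟩
  have H0 : ∀ a, H (0, a) = E.proj (f₀ a) := fun a => by
    change toSphere n (AffineMap.lineMap (g a) (f a) ((0 : unitInterval) : ℝ)) = E.proj (σ a)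
    rw [hσg a a.2]
    simp
  let L := E.isPrincipal.isCoveringMap.liftHomotopy H f₀ H0
  have hL : ∀ q, E.proj (L q) = H q := congr_fun (E.isPrincipal.isCoveringMap.liftHomotopy_lifts H f₀ H0)
  classical
  refine ⟨fun z => if hz : z ∈ U then L (1, ⟨z, hz⟩) else σ z, ?_, fun z hz => ?_⟩
  · rw [continuousOn_iff_continuous_domRestrict]
    refine (L.continuous.comp (Continuous.prodMk_right 1)).congr fun z => ?_
    simp
  · simp only [dif_pos hz, hL]
    simp [H]

/-- The contraction is run backwards: a constant map lifts, hence so do `pushDown`, `pushAside` and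
finally the identity. -/
theorem exists_isSection_cutPlane (E : GCover G n) : ∃ σ, IsSection E (cutPlane n) σ := by
  have h1 : HasLift E (cutPlane n) (pushDown n) :=
    (hasLift_const E _ (-Complex.I)).of_lineMap (continuousOn_pushDown n) continuousOn_const
      fun z _ t ht => cutPlane_subset n <| mem_cutPlane_of_im <| by
        have := (convex_halfSpace_im_le (-1)).lineMap_mem (pushDown_im_le n z)
          (show (-Complex.I).im ≤ -1 by simp) ht
        exact le_trans this (by norm_num)
  have h2 : HasLift E (cutPlane n) (pushAside n) :=
    h1.of_lineMap (continuousOn_pushAside n) (continuousOn_pushDown n)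
      fun z hz t ht => cutPlane_subset n (lineMap_pushDown_mem hz ht)
  have h3 : HasLift E (cutPlane n) id :=
    h2.of_lineMap continuousOn_id (continuousOn_pushAside n)
      fun z hz t ht => cutPlane_subset n (lineMap_pushAside_mem hz ht)
  obtain ⟨σ, h4, h5⟩ := h3
  exact ⟨σ, h4, h5⟩

theorem exists_isSection_upperSphere (E : GCover G n) : ∃ σ, IsSection E (upperSphere n) σ := by
  have h1 : HasLift E (upperSphere n) (fun z => z + Complex.I) :=
    (hasLift_const E _ Complex.I).of_lineMap (by fun_prop) continuousOn_const
      fun z hz t ht => mem_finiteSphere_of_im <| by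
        have := (convex_halfSpace_im_ge 1).lineMap_mem
          (show 1 ≤ (z + Complex.I).im by simpa using hz.2.le)
          (show 1 ≤ Complex.I.im by simp) ht
        exact le_trans (by norm_num) this
  have h2 : HasLift E (upperSphere n) id :=
    h1.of_lineMap continuousOn_id (by fun_prop)
      fun z hz t ht => upperSphere_subset n (lineMap_up_mem hz ht)
  obtain ⟨σ, h4, h5⟩ := h2
  exact ⟨σ, h4, h5⟩

/-! ### Fibers as torsors, and uniqueness of sections -/

theorem GCover.proj_smul (E : GCover G n) (a : G) (e : E.Total) : E.proj (a • e) = E.proj e :=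
  E.isPrincipal.map_smul a

theorem GCover.eq_of_smul_eq (E : GCover G n) {a b : G} {e : E.Total} (h : a • e = b • e) : a = b :=
  have := E.isPrincipal.isCancelSMul
  IsCancelSMul.right_cancel a b e h

theorem GCover.exists_smul_eq (E : GCover G n) {e e' : E.Total} (h : E.proj e = E.proj e') :
    ∃ a : G, a • e' = e :=
  E.isPrincipal.apply_eq_iff_mem_orbit.1 h

namespace IsSection

variable {E F : GCover G n} {U V : Set ℂ} {σ σ' : ℂ → E.Total}

theorem mono (h : IsSection E U σ) (hVU : V ⊆ U) : IsSection E V σ :=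
  ⟨h.continuousOn.mono hVU, fun z hz => h.proj_eq z (hVU hz)⟩

theorem smul (h : IsSection E U σ) (a : G) : IsSection E U fun z => a • σ z :=
  have := E.isPrincipal.toContinuousConstSMul
  ⟨h.continuousOn.const_smul a, fun z hz => by rw [E.proj_smul, h.proj_eq z hz]⟩

theorem map (h : IsSection E U σ) (φ : E ⟶ F) : IsSection F U fun z => φ.toHomeo (σ z) :=
  ⟨φ.toHomeo.continuous.comp_continuousOn h.continuousOn,
    fun z hz => by rw [φ.proj_map, h.proj_eq z hz]⟩

theorem eqOn (h : IsSection E U σ) (h' : IsSection E U σ') (hU : IsPreconnected U) {z : ℂ}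
    (hz : z ∈ U) (hzz : σ z = σ' z) : EqOn σ σ' U :=
  E.isPrincipal.isCoveringMap.eqOn_of_comp_eqOn hU h.continuousOn h'.continuousOn
    (fun w hw => (h.proj_eq w hw).trans (h'.proj_eq w hw).symm) hz hzz

/-- One fiber is one orbit, which gives `a` at a single point; unique lifting over the preconnected
`U` spreads the same `a` everywhere. All constants of `G` attached to a cover arise in this way. -/
theorem exists_eq_smul (h : IsSection E U σ) (h' : IsSection E U σ') (hU : IsPreconnected U) :
    ∃ a : G, ∀ z ∈ U, σ' z = a • σ z := by
  rcases U.eq_empty_or_nonempty with rfl | ⟨z, hz⟩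
  · exact ⟨1, fun z hz => absurd hz (notMem_empty z)⟩
  · obtain ⟨a, ha⟩ := E.exists_smul_eq ((h'.proj_eq z hz).trans (h.proj_eq z hz).symm)
    exact ⟨a, h'.eqOn (h.smul a) hU hz ha.symm⟩

theorem continuousAt_toPlane (h : IsSection E U σ) {z : ℂ} (hz : z ∈ finiteSphere n)
    (hU : U ∈ 𝓝[finiteSphere n] z) (hzU : z ∈ U) :
    ContinuousAt (fun p => σ (toPlane p)) (toSphere n z) := by
  have h1 : ContinuousWithinAt σ (finiteSphere n) z :=
    (h.continuousOn z hzU).mono_of_mem_nhdsWithin hU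
  unfold ContinuousAt
  beta_reduce
  rw [toPlane_toSphere hz]
  exact h1.tendsto.comp (tendsto_toPlane hz)

end IsSection

/-- A section near `∞`. -/
theorem exists_section_near_infty (E : GCover G n) :
    ∃ (s : StdSphere n → E.Total) (R : ℝ), ContinuousAt s (inftyPoint n) ∧
      E.proj (s (inftyPoint n)) = inftyPoint n ∧ (n : ℝ) + 1 < R ∧
      (∀ z : ℂ, R < ‖z‖ → z ∈ finiteSphere n) ∧
      IsSection E {z | R < ‖z‖} fun z => s (toSphere n z) := by
  obtain ⟨e, he⟩ := E.isPrincipal.surjective (inftyPoint n)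
  obtain ⟨f, hef, hf⟩ := E.isPrincipal.isCoveringMap.isLocalHomeomorph e
  have hi : inftyPoint n ∈ f.target := by
    rw [← he, hf]; exact f.map_source hef
  obtain ⟨R, hR, h⟩ := exists_norm_of_mem_nhds (f.open_target.mem_nhds hi)
  refine ⟨f.symm, R, f.continuousAt_symm hi, ?_, hR, fun z hz => (h z hz).1, ?_, fun z hz => ?_⟩
  · rw [hf]; exact f.right_inv hi
  · exact f.continuousOn_symm.comp ((continuousOn_toSphere n).mono fun z hz => (h z hz).1)
      fun z hz => (h z hz).2
  · rw [hf]; exact f.right_inv (h z hz).2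

/-! ### Partial products -/

/-- The product of the first `m` entries of `g`. -/
def partialProd (g : Fin n → G) (m : ℕ) : G :=
  (List.ofFn fun k : Fin n => if (k : ℕ) < m then g k else 1).prod

theorem partialProd_zero (g : Fin n → G) : partialProd g 0 = 1 := by
  simp [partialProd]

theorem partialProd_castSucc (g : Fin (n + 1) → G) (m : ℕ) :
    partialProd g m =
      partialProd (fun k => g k.castSucc) m * if n < m then g (Fin.last n) else 1 := by
  rw [partialProd, List.ofFn_succ']
  simp [partialProd]

theorem partialProd_of_le (g : Fin n → G) {m : ℕ} (hm : n ≤ m) :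
    partialProd g m = (List.ofFn g).prod := by
  rw [partialProd]
  congr 2
  funext k
  exact if_pos (k.2.trans_le hm)

theorem partialProd_succ (g : Fin n → G) (k : Fin n) :
    partialProd g (k + 1) = partialProd g k * g k := by
  induction n with
  | zero => exact k.elim0
  | succ n ih =>
    rw [partialProd_castSucc, partialProd_castSucc]
    induction k using Fin.lastCases with
    | last =>
      rw [partialProd_of_le _ (by simp), partialProd_of_le _ (by simp)]
      simp
    | cast k =>
      have h1 : ¬ n < (k.castSucc : ℕ) + 1 := by simp
      have h2 : ¬ n < (k.castSucc : ℕ) := by simp [k.2.le]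
      rw [if_neg h1, if_neg h2, mul_one, mul_one]
      exact ih (fun k => g k.castSucc) k

/-- The product telescopes. Thus any sequence of transition constants starting at `1` is the
sequence of partial products of suitable cut labels. -/
theorem partialProd_div (a : ℕ → G) {m : ℕ} (hm : m ≤ n) :
    partialProd (fun k : Fin n => (a k)⁻¹ * a (k + 1)) m = (a 0)⁻¹ * a m := by
  induction m with
  | zero => simp [partialProd_zero]
  | succ m ih =>
    rw [partialProd_succ _ (⟨m, hm⟩ : Fin n), ih (by omega)]
    simp [mul_assoc]

/-! ### The gluing data in plane coordinates -/

theorem shift_coe_of_pos (t : StdBlock G n) {z : ℂ} (hz : 0 < z.im) :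
    shift t (z : OnePoint ℂ) = partialProd t.g (sector n z.re) := by
  change (if 0 < z.im then _ else (1 : G)) = _
  rw [if_pos hz, partialProd]
  simp only [lt_sector_iff]

theorem shift_coe_of_nonpos (t : StdBlock G n) {z : ℂ} (hz : z.im ≤ 0) :
    shift t (z : OnePoint ℂ) = 1 := if_neg hz.not_gt

theorem toSphere_mem_cutSphere {z : ℂ} (hz : z ∈ finiteSphere n) :
    toSphere n z ∈ cutSphere n ↔ z ∈ cutPlane n := by
  rw [toSphere_of_mem hz, coe_mem_cutSphere]

theorem toSphere_mem_nearCuts {z : ℂ} (hz : z ∈ upperSphere n) : toSphere n z ∈ nearCuts n := by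
  rw [toSphere_of_mem hz.1]
  rintro ⟨w, hw, hwz⟩
  have : w = z := OnePoint.coe_injective hwz
  subst this
  exact absurd hz.2 hw.1.not_gt

theorem inftyPoint_mem_nearCuts : inftyPoint n ∈ nearCuts n := by
  rintro ⟨w, -, hw⟩
  exact OnePoint.coe_ne_infty w hw

theorem mem_upperSphere_of_notMem {z : ℂ} (hz : z ∈ finiteSphere n) (h : z ∉ cutPlane n) :
    z ∈ upperSphere n := by
  have h1 : ∃ k : Fin n, z.re = k + 1 ∧ 0 ≤ z.im := by
    by_contra hc
    push Not at hc
    exact h ⟨hz, hc⟩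
  obtain ⟨k, hk, h0⟩ := h1
  have h2 := mem_finiteSphere.1 hz k
  rw [hk] at h2
  refine ⟨hz, lt_of_le_of_ne h0 fun h3 => ?_⟩
  rw [← h3] at h2
  norm_num at h2

theorem basePointC_mem_cutPlane (k : Fin n) : basePointC k ∈ cutPlane n :=
  mem_cutPlane_of_im (by simp [basePointC])

theorem toSphere_basePointC (k : Fin n) : toSphere n (basePointC k) = basePoint k :=
  toSphere_of_mem (basePointC_mem k)

/-! ### Isomorphisms of `G`-covers -/

theorem GCover.continuousConstSMul (E : GCover G n) : ContinuousConstSMul G E.Total :=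
  E.isPrincipal.toContinuousConstSMul

/-- A continuous equivariant map over `S_n` which preserves the chosen points is an isomorphism. -/
theorem exists_iso_of_continuous (E F : GCover G n) (f : E.Total → F.Total) (hf : Continuous f)
    (hproj : ∀ e, F.proj (f e) = E.proj e) (hsmul : ∀ (a : G) e, f (a • e) = a • f e)
    (hpt : ∀ k, f (E.pt k) = F.pt k) : ∃ φ : E ⟶ F, ∀ e, φ.toHomeo e = f e := by
  -- A continuous map over the base between two coverings is a local homeomorphism, and an
  -- equivariant map of torsors is bijective on each fiber.
  have h1 : IsLocalHomeomorph f := by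
    have h : F.proj ∘ f = E.proj := funext hproj
    refine IsLocalHomeomorph.of_comp (g := F.proj) ?_
      F.isPrincipal.isCoveringMap.isLocalHomeomorph hf
    rw [h]
    exact E.isPrincipal.isCoveringMap.isLocalHomeomorph
  have h2 : Function.Bijective f := by
    constructor
    · intro e e' h
      have h3 : E.proj e = E.proj e' := by rw [← hproj, ← hproj, h]
      obtain ⟨a, rfl⟩ := E.exists_smul_eq h3
      have h4 : a • f e' = (1 : G) • f e' := by rw [← hsmul, h, one_smul]
      rw [F.eq_of_smul_eq h4, one_smul]
    · intro y
      obtain ⟨e, he⟩ := E.isPrincipal.surjective (F.proj y)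
      obtain ⟨a, ha⟩ := F.exists_smul_eq (he.symm.trans (hproj e).symm)
      exact ⟨a • e, by rw [hsmul, ha]⟩
  exact ⟨⟨(Equiv.ofBijective f h2).toHomeomorphOfContinuousOpen hf h1.isOpenMap, hpt, hproj, hsmul⟩,
    fun _ => rfl⟩

/-- An isomorphism of `G`-covers is determined by its values over one point. -/
theorem iso_ext_of_eq {E F : GCover G n} (φ ψ : E ⟶ F) {z : ℂ} (hz : z ∈ cutPlane n)
    (h : ∀ e, E.proj e = toSphere n z → φ.toHomeo e = ψ.toHomeo e) : φ = ψ := by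
  have fib : ∀ {e e'}, E.proj e = E.proj e' → φ.toHomeo e' = ψ.toHomeo e' →
      φ.toHomeo e = ψ.toHomeo e := by
    intro e e' hee h
    obtain ⟨a, rfl⟩ := E.exists_smul_eq hee
    rw [φ.map_smul, ψ.map_smul, h]
  have on : ∀ {U : Set ℂ} {σ : ℂ → E.Total}, IsSection E U σ → IsPreconnected U → ∀ {w},
      w ∈ U → φ.toHomeo (σ w) = ψ.toHomeo (σ w) → ∀ e, ∀ y ∈ U, E.proj e = toSphere n y →
      φ.toHomeo e = ψ.toHomeo e := by
    intro U σ hσ hU w hw hww e y hy he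
    exact fib (he.trans (hσ.proj_eq y hy).symm) ((hσ.map φ).eqOn (hσ.map ψ) hU hw hww hy)
  obtain ⟨σ, hσ⟩ := exists_isSection_cutPlane E
  obtain ⟨σ', hσ'⟩ := exists_isSection_upperSphere E
  have hcut := on hσ (isPreconnected_cutPlane n) hz (h _ (hσ.proj_eq z hz))
  -- The point `1/2 + i` lies in both regions, and agreement passes through it from `cutPlane` to
  -- `upperSphere`.
  have hw := middle_mem_upperStrip (n := n) (m := 0) (Nat.zero_le n) (z := ⟨((0 : ℕ) : ℝ) + 1 / 2, 1⟩)
    rfl one_pos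
  have hw' : (⟨((0 : ℕ) : ℝ) + 1 / 2, 1⟩ : ℂ) ∈ upperSphere n := ⟨hw.1.1, hw.2.1⟩
  have hupper := on hσ' (isPreconnected_upperSphere n) hw' (hcut _ _ hw.1 (hσ'.proj_eq _ hw'))
  have hfin : ∀ e, ∀ y ∈ finiteSphere n, E.proj e = toSphere n y → φ.toHomeo e = ψ.toHomeo e := by
    intro e y hy he
    by_cases hyc : y ∈ cutPlane n
    · exact hcut e y hyc he
    · exact hupper e y (mem_upperSphere_of_notMem hy hyc) he
  refine GCover.Iso.ext (Homeomorph.ext fun e => ?_)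
  rcases eq_inftyPoint_or (E.proj e) with he | ⟨y, hy, he⟩
  · obtain ⟨s, R, hs, hs1, hR, hRf, hsec⟩ := exists_section_near_infty E
    refine fib (e' := s (inftyPoint n)) (he.trans hs1.symm) ?_
    -- The agreement locus is closed because a covering is separated over its base. A disagreement
    -- at `s ∞` would therefore persist along `s` at finite points near `∞`.
    have hcl : IsClosed {e | φ.toHomeo e = ψ.toHomeo e} :=
      F.isPrincipal.isCoveringMap.isSeparatedMap.isClosed_eqLocus φ.toHomeo.continuous
        ψ.toHomeo.continuous (funext fun e => (φ.proj_map e).trans (ψ.proj_map e).symm)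
    by_contra hne
    have hV := hs.preimage_mem_nhds (hcl.isOpen_compl.mem_nhds hne)
    obtain ⟨R', -, hR'⟩ := exists_norm_of_mem_nhds hV
    have hbig : max R R' < ‖(((|max R R'| + 1 : ℝ)) : ℂ)‖ := by
      rw [Complex.norm_real, Real.norm_of_nonneg (by positivity)]
      linarith [le_abs_self (max R R')]
    refine (hR' _ ((le_max_right _ _).trans_lt hbig)).2 (hfin _ _ (hRf _ ?_) (hsec.proj_eq _ ?_)) <;>
      exact (le_max_left _ _).trans_lt hbig
  · exact hfin e y hy he

section Block

variable [TopologicalSpace G] [DiscreteTopology G]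

theorem chartShift_indexAt (t : StdBlock G n) (p : StdSphere n) :
    (p ∈ cutSphere n → chartShift t ((blockCore t).indexAt p) p = 1) ∧
      (p ∉ cutSphere n → chartShift t ((blockCore t).indexAt p) p = shift t p) := by
  constructor <;> intro h <;> simp [blockCore, chartShift, h]

/-! ### Sections of a standard block -/

theorem exists_eq_blockPt {t : StdBlock G n} {p : StdSphere n} {e : (block t).Total}
    (he : (block t).proj e = p) : ∃ v, e = blockPt t p v := by
  subst he
  exact ⟨label t e, rfl⟩

/-- The section of a standard block with constant label `1` in one of the two charts. -/
theorem isSection_block (t : StdBlock G n) (i : Bool) {U : Set ℂ} (hU : U ⊆ finiteSphere n)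
    (hi : ∀ z ∈ U, toSphere n z ∈ chartDomain n i) :
    IsSection (block t) U fun z => blockPt t (toSphere n z)
      (chartShift t i (toSphere n z) *
        (chartShift t ((blockCore t).indexAt (toSphere n z)) (toSphere n z))⁻¹) := by
  refine ⟨?_, fun _ _ => rfl⟩
  have h1 := ((blockCore t).localTriv i).toOpenPartialHomeomorph.continuousOn_symm
  have h2 : ContinuousOn (fun z => (toSphere n z, (1 : G))) U :=
    ((continuousOn_toSphere n).mono hU).prodMk continuousOn_const
  refine (h1.comp h2 fun z hz => ?_).congr fun z hz => ?_
  · exact (((blockCore t).localTriv i).mem_target).2 (hi z hz)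
  · refine congrArg (blockPt t _) ?_
    change _ = (blockCore t).coordChange i ((blockCore t).indexAt (toSphere n z)) (toSphere n z) 1
    simp [blockCore]

theorem isSection_block_cutPlane (t : StdBlock G n) :
    IsSection (block t) (cutPlane n) fun z => blockPt t (toSphere n z) 1 := by
  have hc : ∀ z ∈ cutPlane n, toSphere n z ∈ cutSphere n := fun z hz =>
    (toSphere_mem_cutSphere hz.1).2 hz
  have h := isSection_block t true (cutPlane_subset n) hc
  refine ⟨h.continuousOn.congr fun z hz => ?_, fun _ _ => rfl⟩
  beta_reduce
  rw [(chartShift_indexAt t _).1 (hc z hz)]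
  simp [chartShift]
  rfl

theorem exists_isSection_block_upperSphere (t : StdBlock G n) :
    ∃ σ, IsSection (block t) (upperSphere n) σ ∧ ∀ z ∈ cutPlane n, 0 < z.im →
      σ z = blockPt t (toSphere n z) (partialProd t.g (sector n z.re)) := by
  refine ⟨_, isSection_block t false (upperSphere_subset n) fun z hz => toSphere_mem_nearCuts hz,
    fun z hz h0 => ?_⟩
  rw [(chartShift_indexAt t _).1 ((toSphere_mem_cutSphere hz.1).2 hz)]
  simp [chartShift, coe_toSphere hz.1, shift_coe_of_pos t h0]
  rfl

theorem blockPt_injective {t : StdBlock G n} {p : StdSphere n} {v w : G}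
    (h : blockPt t p v = blockPt t p w) : v = w :=
  eq_of_heq (Bundle.TotalSpace.mk.inj h).2

/-! ### Maps out of a standard block -/

/-- The hypothesis `h` says that `τ` is `σ` corrected by the change of label from the chart used at
each point to the chart `i`. So `label x • τ x.1` equals the label of `x` in chart `i` acting on
`σ`; that label is locally constant and `σ` is continuous, although `τ` need not be. -/
theorem continuousAt_of_chart (t : StdBlock G n) (E : GCover G n) (τ σ : StdSphere n → E.Total)
    (i : Bool) (e : (blockCore t).TotalSpace) (he : e.1 ∈ chartDomain n i)
    (hσ : ContinuousAt σ e.1)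
    (h : ∀ᶠ q in 𝓝 e.1, τ q =
      (chartShift t ((blockCore t).indexAt q) q * (chartShift t i q)⁻¹) • σ q) :
    ContinuousAt (fun x : (blockCore t).TotalSpace => label t x • τ x.1) e := by
  have := E.continuousConstSMul
  let T := (blockCore t).localTriv i
  have h1 : ContinuousAt (fun x => (T x).2) e :=
    continuous_snd.continuousAt.comp (T.continuousAt ((blockCore t).mem_localTriv_source i e |>.2 he))
  have h2 : ∀ᶠ x in 𝓝 e, (T x).2 = (T e).2 :=
    h1.eventually (show ∀ᶠ y in 𝓝 (T e).2, y = (T e).2 by simp [nhds_discrete])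
  have h3 : ContinuousAt (fun x : (blockCore t).TotalSpace => x.1) e :=
    (blockCore t).continuous_proj.continuousAt
  have h4 : ContinuousAt (fun x : (blockCore t).TotalSpace => (T e).2 • σ x.1) e :=
    (ContinuousAt.comp (f := fun x : (blockCore t).TotalSpace => x.1) hσ h3).const_smul _
  refine h4.congr ?_
  filter_upwards [h2, h3.eventually h] with x hx hx'
  rw [← hx, hx', smul_smul, ← mul_assoc]
  rfl

end Block

/-! ### Neighborhoods in `S_n` in plane coordinates -/

theorem eventually_eq_toSphere {U : Set ℂ} {z : ℂ} (hz : z ∈ finiteSphere n)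
    (hU : U ∈ 𝓝[finiteSphere n] z) : ∀ᶠ q in 𝓝 (toSphere n z), ∃ w ∈ U, q = toSphere n w := by
  have hne : toSphere n z ≠ inftyPoint n := fun h => by
    have := congrArg Subtype.val h
    rw [coe_toSphere hz] at this
    exact OnePoint.coe_ne_infty z this
  filter_upwards [isOpen_ne.mem_nhds hne, tendsto_toPlane hz hU] with q h1 h2
  rcases eq_inftyPoint_or q with h | ⟨w, hw, rfl⟩
  · exact absurd h h1
  · rw [mem_preimage, toPlane_toSphere hw] at h2
    exact ⟨w, h2, rfl⟩

theorem eventually_eq_inftyPoint_or (n : ℕ) (R : ℝ) :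
    ∀ᶠ q in 𝓝 (inftyPoint n), q = inftyPoint n ∨
      ∃ w ∈ finiteSphere n, R < ‖w‖ ∧ q = toSphere n w := by
  have h1 : IsOpen (((↑) : ℂ → OnePoint ℂ) '' Metric.closedBall 0 R)ᶜ :=
    OnePoint.isOpen_compl_image_coe.2 ⟨Metric.isClosed_closedBall, isCompact_closedBall 0 R⟩
  have h2 : inftyPoint n ∈ (Subtype.val ⁻¹' (((↑) : ℂ → OnePoint ℂ) '' Metric.closedBall 0 R)ᶜ :
      Set (StdSphere n)) := by
    rintro ⟨w, -, hw⟩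
    exact OnePoint.coe_ne_infty w hw
  filter_upwards [(h1.preimage continuous_subtype_val).mem_nhds h2] with q hq
  rcases eq_inftyPoint_or q with h | ⟨w, hw, rfl⟩
  · exact Or.inl h
  · refine Or.inr ⟨w, hw, not_le.1 fun h => hq ⟨w, by simpa using h, (coe_toSphere hw).symm⟩, rfl⟩

/-! ### Fullness and essential surjectivity -/

section Block

variable [TopologicalSpace G] [DiscreteTopology G]

/-- Every isomorphism between standard blocks comes from an element of `G`. -/
theorem exists_blockMap_eq {s t : StdBlock G n} (φ : block s ⟶ block t) :
    ∃ a : s ⟶ t, blockMap a = φ := by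
  obtain ⟨c, hc⟩ := (isSection_block_cutPlane t).exists_eq_smul
    ((isSection_block_cutPlane s).map φ) (isPreconnected_cutPlane n)
  obtain ⟨σs, hσs, hs⟩ := exists_isSection_block_upperSphere s
  obtain ⟨σt, hσt, ht⟩ := exists_isSection_block_upperSphere t
  obtain ⟨d, hd⟩ := hσt.exists_eq_smul (hσs.map φ) (isPreconnected_upperSphere n)
  have hφ : ∀ z ∈ cutPlane n, ∀ v, φ.toHomeo (blockPt s (toSphere n z) v) =
      blockPt t (toSphere n z) (v * c) := by
    intro z hz v
    have h1 : φ.toHomeo (blockPt s (toSphere n z) (v * 1)) =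
        blockPt t (toSphere n z) (v * (c * 1)) :=
      (φ.map_smul v (blockPt s (toSphere n z) 1)).trans (congrArg (v • ·) (hc z hz))
    rwa [mul_one, mul_one] at h1
  -- Evaluate both descriptions of `φ` at `m + 1/2 + i`, in the `m`-th strip: there the upper
  -- section of a block has the partial product of the first `m` labels as its label.
  have key : ∀ m ≤ n, partialProd s.g m * c = d * partialProd t.g m := by
    intro m hm
    obtain ⟨hz, him, hsec⟩ := middle_mem_upperStrip hm (z := ⟨(m : ℝ) + 1 / 2, 1⟩) rfl one_pos
    have h1 := hd _ ⟨hz.1, him⟩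
    rw [hs _ hz him, ht _ hz him, hsec, hφ _ hz] at h1
    exact blockPt_injective h1
  have hcd : c = d := by simpa [partialProd_zero] using key 0 (Nat.zero_le n)
  subst hcd
  -- Since `φ_x` multiplies labels by `x⁻¹` and `φ` multiplies them by `c`, the element sought is
  -- `c⁻¹`. Two consecutive instances of `key` isolate the label of one cut.
  have hg : ∀ i, c⁻¹ * s.g i * (c⁻¹)⁻¹ = t.g i := by
    intro i
    have h1 := key (i + 1) i.2
    rw [partialProd_succ, partialProd_succ, ← mul_assoc, ← key i i.2.le, mul_assoc, mul_assoc] at h1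
    rw [inv_inv, mul_assoc, mul_left_cancel h1, inv_mul_cancel_left]
  have hh : ∀ i, s.h i * (c⁻¹)⁻¹ = t.h i := by
    intro i
    have h1 := φ.map_pt i
    have h2 := hφ _ (basePointC_mem_cutPlane i) (s.h i)
    rw [toSphere_basePointC] at h2
    rw [inv_inv]
    exact blockPt_injective (h2.symm.trans h1)
  let a : s ⟶ t := (⟨c⁻¹, hg, hh⟩ : StdBlock.Iso s t)
  have hz : -Complex.I ∈ cutPlane n := mem_cutPlane_of_im (by simp; norm_num)
  refine ⟨a, iso_ext_of_eq _ _ hz fun e he => ?_⟩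
  obtain ⟨v, rfl⟩ := exists_eq_blockPt he
  rw [hφ _ hz]
  change blockPt t (toSphere n (-Complex.I)) (v * (c⁻¹)⁻¹) = _
  rw [inv_inv]

/-- A standard block maps to `E` if `E` has compatible sections over the plane minus the cuts, over
the upper half-plane and near `∞`. -/
theorem exists_iso_of_sections (t : StdBlock G n) (E : GCover G n) {σc σu : ℂ → E.Total}
    (hc : IsSection E (cutPlane n) σc) (hu : IsSection E (upperSphere n) σu)
    (hcu : ∀ z ∈ cutPlane n, 0 < z.im → σu z = partialProd t.g (sector n z.re) • σc z)
    {s : StdSphere n → E.Total} {R : ℝ} (hs : ContinuousAt s (inftyPoint n))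
    (hs' : E.proj (s (inftyPoint n)) = inftyPoint n)
    (hsu : ∀ z ∈ upperSphere n, R < ‖z‖ → s (toSphere n z) = σu z)
    (hsc : ∀ z ∈ cutPlane n, z.im ≤ 0 → R < ‖z‖ → s (toSphere n z) = σc z)
    (hpt : ∀ k, t.h k • σc (basePointC k) = E.pt k) : Nonempty (block t ⟶ E) := by
  classical
  -- This is the intended image of the points with label `1`: `σc` off the cuts, `σu` on them, and
  -- `s` at `∞`. It may jump at the cuts; the map `label x • τ x.1` does not.
  let τ : StdSphere n → E.Total := fun p =>
    if p = inftyPoint n then s p else if toPlane p ∈ cutPlane n then σc (toPlane p)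
      else σu (toPlane p)
  have hne : ∀ z ∈ finiteSphere n, toSphere n z ≠ inftyPoint n := fun z hz h => by
    have := congrArg Subtype.val h
    rw [coe_toSphere hz] at this
    exact OnePoint.coe_ne_infty z this
  have τi : τ (inftyPoint n) = s (inftyPoint n) := if_pos rfl
  have τc : ∀ z ∈ cutPlane n, τ (toSphere n z) = σc z := fun z hz => by
    simp only [τ]
    rw [if_neg (hne z hz.1), toPlane_toSphere hz.1, if_pos hz]
  have τu : ∀ z ∈ finiteSphere n, z ∉ cutPlane n → τ (toSphere n z) = σu z := fun z hz hz' => by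
    simp only [τ]
    rw [if_neg (hne z hz), toPlane_toSphere hz, if_neg hz']
  have hτ : ∀ p, E.proj (τ p) = p := by
    intro p
    rcases eq_inftyPoint_or p with rfl | ⟨z, hz, rfl⟩
    · rw [τi, hs']
    · by_cases hzc : z ∈ cutPlane n
      · rw [τc z hzc, hc.proj_eq z hzc]
      · rw [τu z hz hzc, hu.proj_eq z (mem_upperSphere_of_notMem hz hzc)]
  have near : ∀ w ∈ upperSphere n, τ (toSphere n w) =
      (chartShift t ((blockCore t).indexAt (toSphere n w)) (toSphere n w) *
        (chartShift t false (toSphere n w))⁻¹) • σu w := by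
    intro w hw
    by_cases hwc : w ∈ cutPlane n
    · rw [τc w hwc, (chartShift_indexAt t _).1 ((toSphere_mem_cutSphere hw.1).2 hwc),
        hcu w hwc hw.2, one_mul, chartShift, if_neg (by simp), coe_toSphere hw.1,
        shift_coe_of_pos t hw.2, inv_smul_smul]
    · rw [τu w hw.1 hwc,
        (chartShift_indexAt t _).2 (mt (toSphere_mem_cutSphere hw.1).1 hwc), chartShift,
        if_neg (by simp), mul_inv_cancel, one_smul]
  have hcont : Continuous (fun x : (blockCore t).TotalSpace => label t x • τ x.1) := by
    rw [continuous_iff_continuousAt]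
    rintro ⟨p, v⟩
    rcases eq_inftyPoint_or p with rfl | ⟨z, hz, rfl⟩
    · refine continuousAt_of_chart t E τ s false _ inftyPoint_mem_nearCuts hs ?_
      filter_upwards [eventually_eq_inftyPoint_or n R] with q hq
      rcases hq with rfl | ⟨w, hw, hwR, rfl⟩
      -- The chart used at `∞` depends on whether `n = 0`, but both chart shifts are `1` there.
      · have h1 : ∀ i, chartShift t i (inftyPoint n) = 1 := by
          intro i
          cases i <;> rfl
        rw [h1, h1, τi, inv_one, mul_one, one_smul]
      · rcases lt_or_ge 0 w.im with h0 | h0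
        · rw [hsu w ⟨hw, h0⟩ hwR]
          exact near w ⟨hw, h0⟩
        · have hwc : w ∈ cutPlane n := by
            by_contra h
            exact absurd (mem_upperSphere_of_notMem hw h).2 h0.not_gt
          rw [hsc w hwc h0 hwR, τc w hwc,
            (chartShift_indexAt t _).1 ((toSphere_mem_cutSphere hw).2 hwc), chartShift,
            if_neg (by simp), coe_toSphere hw, shift_coe_of_nonpos t h0, inv_one, mul_one, one_smul]
    · by_cases hzc : z ∈ cutPlane n
      · have hU := cutPlane_mem_nhdsWithin hzc
        refine continuousAt_of_chart t E τ (fun p => σc (toPlane p)) true _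
          ((toSphere_mem_cutSphere hz).2 hzc) (hc.continuousAt_toPlane hz hU hzc) ?_
        filter_upwards [eventually_eq_toSphere hz hU] with q hq
        obtain ⟨w, hw, rfl⟩ := hq
        rw [τc w hw, (chartShift_indexAt t _).1 ((toSphere_mem_cutSphere hw.1).2 hw), chartShift,
          if_pos rfl, inv_one, mul_one, one_smul, toPlane_toSphere hw.1]
      · have hzu := mem_upperSphere_of_notMem hz hzc
        have hU := upperSphere_mem_nhdsWithin hzu
        refine continuousAt_of_chart t E τ (fun p => σu (toPlane p)) false _
          (toSphere_mem_nearCuts hzu) (hu.continuousAt_toPlane hz hU hzu) ?_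
        filter_upwards [eventually_eq_toSphere hz hU] with q hq
        obtain ⟨w, hw, rfl⟩ := hq
        rw [near w hw, toPlane_toSphere hw.1]
  obtain ⟨φ, -⟩ := exists_iso_of_continuous (block t) E
    (fun x : (blockCore t).TotalSpace => label t x • τ x.1) hcont
    (fun e => by rw [E.proj_smul, hτ]; rfl) (fun a e => mul_smul a (label t e) _)
    (fun k => by
      change t.h k • τ (basePoint k) = _
      rw [← toSphere_basePointC, τc _ (basePointC_mem_cutPlane k), hpt])
  exact ⟨φ⟩

/-- Every `G`-cover of `S_n` is isomorphic to a standard block. -/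
theorem exists_block_iso (E : GCover G n) : ∃ t : StdBlock G n, Nonempty (block t ⟶ E) := by
  obtain ⟨σc, hc⟩ := exists_isSection_cutPlane E
  obtain ⟨σ, hσ⟩ := exists_isSection_upperSphere E
  have hb : ∀ m : ℕ, ∃ b : G, m ≤ n → ∀ z ∈ upperStrip n m, σ z = b • σc z := by
    intro m
    by_cases hm : m ≤ n
    · obtain ⟨b, hb⟩ := IsSection.exists_eq_smul (hc.mono fun z (hz : z ∈ upperStrip n m) => hz.1)
        (hσ.mono fun z hz => ⟨hz.1.1, hz.2.1⟩) (isPreconnected_upperStrip hm)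
      exact ⟨b, fun _ => hb⟩
    · exact ⟨1, fun h => absurd h hm⟩
  choose b hb using hb
  -- Dividing by `b 0` makes the two sections agree on the leftmost strip.
  let a : ℕ → G := fun m => (b 0)⁻¹ * b m
  have ha0 : a 0 = 1 := inv_mul_cancel _
  let σu : ℂ → E.Total := fun z => (b 0)⁻¹ • σ z
  have hu : IsSection E (upperSphere n) σu := hσ.smul _
  have hcu : ∀ z ∈ cutPlane n, 0 < z.im → σu z = a (sector n z.re) • σc z := by
    intro z hz h0
    change (b 0)⁻¹ • σ z = _
    rw [hb _ (sector_le n z.re) z ⟨hz, h0, rfl⟩, smul_smul]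
  obtain ⟨s, R, hs, hs', hR, hRf, hsec⟩ := exists_section_near_infty E
  have hn : (0 : ℝ) ≤ n := n.cast_nonneg
  have hR0 : 0 ≤ R := by linarith
  have hright : ∀ z : ℂ, (n : ℝ) + 1 < z.re → R < ‖z‖ → z ∈ cutPlane n ∧ sector n z.re = n := by
    intro z hz hzR
    have hk : ∀ k : Fin n, (k : ℝ) + 1 < z.re := fun k => by
      have : (k : ℝ) < n := by exact_mod_cast k.2
      linarith
    exact ⟨⟨hRf z hzR, fun k h => absurd h (hk k).ne'⟩,
      sector_eq_of le_rfl fun k => ⟨fun _ => k.2, fun _ => hk k⟩⟩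
  have hleft : ∀ z : ℂ, z.re < 0 → R < ‖z‖ → z ∈ cutPlane n ∧ sector n z.re = 0 := by
    intro z hz hzR
    have hk : ∀ k : Fin n, z.re < (k : ℝ) + 1 := fun k => by
      have : (0 : ℝ) ≤ k := Nat.cast_nonneg _
      linarith
    exact ⟨⟨hRf z hzR, fun k h => absurd h (hk k).ne⟩,
      sector_eq_of (Nat.zero_le n) fun k => ⟨fun h => absurd h (hk k).not_gt, fun h => by omega⟩⟩
  have hlower : ∀ z : ℂ, z.im < 0 → R < ‖z‖ → z ∈ cutPlane n := fun z hz hzR =>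
    ⟨hRf z hzR, fun _ _ => hz⟩
  have pL : IsPreconnected {z : ℂ | 0 < -z.re ∧ R < ‖z‖} :=
    isPreconnected_halfPlane_far (-Complex.reCLM) le_rfl hR0 fun z =>
      (neg_le_abs _).trans (Complex.abs_re_le_norm z)
  have pR : IsPreconnected {z : ℂ | (n : ℝ) + 1 < z.re ∧ R < ‖z‖} :=
    isPreconnected_halfPlane_far Complex.reCLM (by linarith) hR0 fun z =>
      (le_abs_self _).trans (Complex.abs_re_le_norm z)
  have pD : IsPreconnected {z : ℂ | 0 < -z.im ∧ R < ‖z‖} :=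
    isPreconnected_halfPlane_far (-Complex.imCLM) le_rfl hR0 fun z =>
      (neg_le_abs _).trans (Complex.abs_im_le_norm z)
  have pU : IsPreconnected {z : ℂ | 0 < z.im ∧ R < ‖z‖} :=
    isPreconnected_halfPlane_far Complex.imCLM le_rfl hR0 fun z =>
      (le_abs_self _).trans (Complex.abs_im_le_norm z)
  have far : ∀ x y : ℝ, R < |x| → R < ‖(⟨x, y⟩ : ℂ)‖ := fun x y hx =>
    hx.trans_le (Complex.abs_re_le_norm ⟨x, y⟩)
  have hpos : R < |R + 1| := by rw [abs_of_nonneg (by linarith)]; linarith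
  have hneg : R < |-(R + 1)| := by rwa [abs_neg]
  -- Far from the origin, the regions `Re < 0`, `Im < 0` and `Re > n + 1` avoid the cuts. The local
  -- section at `∞` is normalized by `d` to equal `σc` on the left; the agreement then passes
  -- through a point in the lower left to the lower half-plane, and through one in the lower right
  -- to the right.
  obtain ⟨d, hd⟩ := IsSection.exists_eq_smul (hsec.mono fun z (hz : 0 < -z.re ∧ R < ‖z‖) => hz.2)
    (hc.mono fun z hz => (hleft z (neg_pos.1 hz.1) hz.2).1) pL
  have := E.continuousConstSMul
  let s' : StdSphere n → E.Total := fun p => d • s p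
  have hsec' : IsSection E {z | R < ‖z‖} fun z => s' (toSphere n z) := hsec.smul d
  have eL : ∀ z : ℂ, z.re < 0 → R < ‖z‖ → s' (toSphere n z) = σc z := fun z hz hzR =>
    (hd z ⟨neg_pos.2 hz, hzR⟩).symm
  have eD : ∀ z : ℂ, z.im < 0 → R < ‖z‖ → s' (toSphere n z) = σc z := fun z hz hzR =>
    IsSection.eqOn (hsec'.mono fun z (hz : 0 < -z.im ∧ R < ‖z‖) => hz.2)
      (hc.mono fun z hz => hlower z (neg_pos.1 hz.1) hz.2) pD
      (z := ⟨-(R + 1), -1⟩) ⟨by simp, far _ _ hneg⟩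
      (eL _ (by change -(R + 1) < 0; linarith) (far _ _ hneg)) ⟨neg_pos.2 hz, hzR⟩
  have eR : ∀ z : ℂ, (n : ℝ) + 1 < z.re → R < ‖z‖ → s' (toSphere n z) = σc z := fun z hz hzR =>
    IsSection.eqOn (hsec'.mono fun z (hz : (n : ℝ) + 1 < z.re ∧ R < ‖z‖) => hz.2)
      (hc.mono fun z hz => (hright z hz.1 hz.2).1) pR
      (z := ⟨R + 1, -1⟩) ⟨by change (n : ℝ) + 1 < R + 1; linarith, far _ _ hpos⟩
      (eD _ (by simp) (far _ _ hpos)) ⟨hz, hzR⟩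
  -- In the upper left `σu = σc` because `a 0 = 1`, so the section at `∞` continues as `σu` over the
  -- far upper half-plane.
  have eU : ∀ z : ℂ, 0 < z.im → R < ‖z‖ → s' (toSphere n z) = σu z := fun z hz hzR => by
    refine IsSection.eqOn (hsec'.mono fun z (hz : 0 < z.im ∧ R < ‖z‖) => hz.2)
      (hu.mono fun z hz => ⟨hRf z hz.2, hz.1⟩) pU
      (z := ⟨-(R + 1), 1⟩) ⟨by simp, far _ _ hneg⟩ ?_ ⟨hz, hzR⟩
    have h1 : (⟨-(R + 1), 1⟩ : ℂ).re < 0 := by change -(R + 1) < 0; linarith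
    obtain ⟨h2, h3⟩ := hleft _ h1 (far (-(R + 1)) 1 hneg)
    rw [hcu _ h2 (by simp), h3, ha0, one_smul]
    exact eL _ h1 (far _ _ hneg)
  -- In the upper right the section at `∞` equals both `σu = a n • σc` and `σc`: a loop around all
  -- the holes has trivial monodromy, since it bounds a disk around `∞`.
  have han : a n = 1 := by
    have h1 : (n : ℝ) + 1 < (⟨R + 1, 1⟩ : ℂ).re := by change (n : ℝ) + 1 < R + 1; linarith
    obtain ⟨h2, h3⟩ := hright _ h1 (far (R + 1) 1 hpos)
    have h4 := hcu _ h2 (by simp)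
    rw [h3, ← eU _ (by simp) (far _ _ hpos), eR _ h1 (far _ _ hpos)] at h4
    exact E.eq_of_smul_eq (h4.symm.trans (one_smul G _).symm)
  have hh : ∀ k : Fin n, ∃ h : G, h • σc (basePointC k) = E.pt k := fun k =>
    E.exists_smul_eq (by
      rw [E.proj_pt, hc.proj_eq _ (basePointC_mem_cutPlane k), toSphere_basePointC])
  choose h hh using hh
  let t : StdBlock G n := ⟨fun k => (a k)⁻¹ * a (k + 1), h, by
    rw [← partialProd_of_le _ le_rfl, partialProd_div a le_rfl, ha0, han, inv_one, one_mul]⟩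
  refine ⟨t, exists_iso_of_sections t E hc hu (fun z hz h0 => ?_) (s := s') (R := R)
    (hs.const_smul d) (by change E.proj (d • s _) = _; rw [E.proj_smul, hs'])
    (fun z hz hzR => eU z hz.2 hzR) (fun z hz h0 hzR => ?_) hh⟩
  · rw [hcu z hz h0, partialProd_div a (sector_le n z.re), ha0, inv_one, one_mul]
  · rcases h0.lt_or_eq with h1 | h1
    · exact eD z h1 hzR
    -- A far point of the real axis lies in the left or in the right region.
    · have h2 : ‖z‖ = |z.re| := by
        rw [Complex.norm_eq_sqrt_sq_add_sq, h1]
        simp [Real.sqrt_sq_eq_abs]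
      rcases lt_abs.1 (h2 ▸ hzR) with h3 | h3
      · exact eR z (by linarith) hzR
      · exact eL z (by linarith) hzR

end Block

end GCovers

end

/-! ### The equivalence of groupoids -/

theorem mainTheorem2 (G : Type u) [Group G] [Finite G] [TopologicalSpace G] [DiscreteTopology G]
    (n : ℕ) :
    (GCovers.blockFunctor G n).IsEquivalence ∧
      Nonempty (GCovers.GCover G n ≌ GCovers.StdBlock G n) ∧
      ∀ E : GCovers.GCover G n, ∃ t : GCovers.StdBlock G n, Nonempty (E ≅ GCovers.block t) := by
  have hiso : ∀ E : GCovers.GCover G n, ∃ t : GCovers.StdBlock G n,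
      Nonempty (E ≅ GCovers.block t) := fun E => by
    obtain ⟨t, ⟨φ⟩⟩ := GCovers.exists_block_iso E
    exact ⟨t, ⟨(asIso φ).symm⟩⟩
  have hequiv : (GCovers.blockFunctor G n).IsEquivalence :=
    -- The point with label `1` over `∞` is sent to the one with label `x⁻¹`, which determines `x`;
    -- the point `∞` belongs to `S_n` for every `n`.
    { faithful := ⟨fun {s t a b} hab => by
        have h := congrArg (fun φ : GCovers.block s ⟶ GCovers.block t =>
          φ.toHomeo (GCovers.blockPt s (GCovers.inftyPoint n) 1)) hab
        have h' : (1 : G) * a.x⁻¹ = 1 * b.x⁻¹ := GCovers.blockPt_injective h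
        exact GCovers.StdBlock.Iso.ext (inv_injective (mul_left_cancel h'))⟩
      full := ⟨fun φ => GCovers.exists_blockMap_eq φ⟩
      essSurj := ⟨fun E => (hiso E).imp fun t ⟨φ⟩ => ⟨φ.symm⟩⟩ }
  exact ⟨hequiv, ⟨(GCovers.blockFunctor G n).asEquivalence.symm⟩, hiso⟩
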